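/- **Conventions.** A *sc-Banach space* $\mathbb E=(E_k)_{k\ge 0}$ is a sequence of real Banach spaces with injective compact linear inclusions $E_{k+1}\hookrightarrow E_k$ such that $E_\infty=\bigcap_k E_k$ is dense in every $E_k$; finite dimensional spaces carry the constant scale, products are formed levelwise, and $T\mathbb E=(E_{k+1}\times E_k)_{k\ge0}$. A map $f:\mathbb E\to\mathbb F$ is $sc^0$ if it restricts to continuous maps $E_k\to F_k$ for all $k$. It is $sc^1$ if moreover for each $x\in E_1$ there is a bounded linear map $df(x):E_0\to F_0$ with $\|f(x+\eta)-f(x)-df(x)\eta\|_{F_0}/\|\eta\|_{E_1}\to0$ as $\|\eta\|_{E_1}\to 0$, and the tangent map $Tf:T\mathbb E\to T\mathbb F$, $(x,\xi)\mapsto(f(x),df(x)\xi)$ is well defined and $sc^0$; in particular $df(x)$ restricts to $E_k\to F_k$ for $x\in E_{k+1}$. It is $sc^{n+1}$ if it is $sc^1$ and $Tf$ is $sc^n$, and *sc-smooth* if it is $sc^n$ for all $n$. A *sc-isomorphism* is a linear map that restricts to a topological isomorphism $E_k\to F_k$ for every $k$. For $k\in\mathbb N_0$, $\delta\ge0$ let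 $H^{k,\delta}(\mathbb R)$ be the completion of $C_c^\infty(\mathbb R)$ (real-valued functions) in the norm $\sum_{i=0}^k\|e^{\delta|x|}\varphi^{(i)}\|_{L^2}$. **Theorem.** Let $0=\delta_0<\delta_1<\delta_2<\cdots$. Then $\mathbb E=(E_k)_{k\ge0}$, $E_k=H^{k,\delta_k}(\mathbb R)$, is a sc-Banach space with $E_0=L^2(\mathbb R)$, and there exist a sc-smooth map $h:\mathbb R\times\mathbb E\to\mathbb E$, $(t,e)\mapsto h_t(e)$, and a sc-smooth map $z:\mathbb R\to\mathbb E$ such that: 1. the partial differential $dh_0(0):\mathbb E\to\mathbb E$ (the differential of $h_0=h(0,\cdot)$ at $e=0$) is a sc-isomorphism; 2. the zero set branches at $(0,0)$: $z(t)=0$ for $t\le0$, $z(t)\ne0$ for $t>0$, and $\{(t,e)\in\mathbb R\times E_0 : h(t,e)=0\}=\{(t,0): t\in\mathbb R\}\cup\{(t,z(t)): t\in\mathbb R\}$; 3. for all $k\ge0$, $t\in\mathbb R$ and $e\in E_{k+1}$, the total differential $dh(t,e):\mathbb R\times E_k\to E_k$ is surjective; 4. for all $k\ge0$, $t\in\mathbb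 R$ and $e\in E_{k+1}$ with $h_t(e)=0$, the differential $dh_t(e):E_k\to E_k$ is surjective; 5. $dh$ extends to all base points in $\mathbb R\times E_0$, with the same surjectivity: there are bounded linear maps $D(t,e):\mathbb R\times E_0\to E_0$ for $(t,e)\in\mathbb R\times E_0$ such that $D(t,e)=dh(t,e)$ for $e\in E_1$; for each fixed $t$ the map $e\mapsto D(t,e)$ is continuous from $E_0$ to the bounded operators with the operator norm (so $D$ is uniquely determined); $D(t,e)$ is the Fréchet derivative of $h:\mathbb R\times E_0\to E_0$ at $(t,e)$ whenever $t\ne0$; $X\mapsto D(t,e)(0,X)$ is the Fréchet derivative of $h_t:E_0\to E_0$ at $e$ for all $(t,e)$; $D(t,e)$ is surjective for all $(t,e)\in\mathbb R\times E_0$; and $X\mapsto D(t,e)(0,X)$ is surjective whenever $h_t(e)=0$. -/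

import Mathlib

open MeasureTheory Filter Topology Asymptotics
open scoped ContDiff ENNReal

/-! ### Scale calculus -/

/-- The data of a scale of real normed spaces: a sequence of normed spaces `E 0, E 1, E 2, …`
with bounded linear inclusion maps `ι k : E (k+1) → E k`. -/
structure ScScale where
  lev : ℕ → Type
  [nacg : ∀ k, NormedAddCommGroup (lev k)]
  [nspace : ∀ k, NormedSpace ℝ (lev k)]
  ι : ∀ k, lev (k + 1) →L[ℝ] lev k

attribute [instance] ScScale.nacg ScScale.nspace

namespace ScScale

/-- The inclusion `E (k+m) → E k`. -/
def incl (E : ScScale) (k : ℕ) : ∀ m : ℕ, E.lev (k + m) →L[ℝ] E.lev k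
  | 0 => ContinuousLinearMap.id ℝ (E.lev k)
  | m + 1 => (incl E k m).comp (E.ι (k + m))

/-- The image in level `k` of the smooth points, i.e. of the intersection of all levels. -/
def smoothPts (E : ScScale) (k : ℕ) : Set (E.lev k) :=
  {x | ∀ m, x ∈ Set.range (E.incl k m)}

/-- A sc-Banach space: every level is complete, the inclusions are injective and compact,
and the intersection of all levels is dense in every level. -/
structure IsScBanach (E : ScScale) : Prop where
  complete : ∀ k, CompleteSpace (E.lev k)
  injective : ∀ k, Function.Injective (E.ι k)
  compact : ∀ k, IsCompactOperator (E.ι k)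
  dense : ∀ k, Dense (E.smoothPts k)

/-- A normed space as a constant scale; it is sc-Banach exactly in finite dimensions. -/
noncomputable abbrev const (V : Type) [NormedAddCommGroup V] [NormedSpace ℝ V] : ScScale where
  lev _ := V
  ι _ := ContinuousLinearMap.id ℝ V

/-- The product scale `(E k × F k)ₖ`. -/
noncomputable abbrev prod (E F : ScScale) : ScScale where
  lev k := E.lev k × F.lev k
  ι k := (E.ι k).prodMap (F.ι k)

/-- The tangent scale `T E = (E (k+1) × E k)ₖ`. -/
noncomputable abbrev tangent (E : ScScale) : ScScale where
  lev k := E.lev (k + 1) × E.lev k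
  ι k := (E.ι (k + 1)).prodMap (E.ι k)

end ScScale

/-- A scale-continuous (`sc⁰`) map: a map `E 0 → F 0` which restricts to continuous maps
`E k → F k` for every `k`, recorded together with these restrictions. -/
structure ScMap (E F : ScScale) where
  toFun : ∀ k, E.lev k → F.lev k
  cont : ∀ k, Continuous (toFun k)
  comm : ∀ k x, toFun k (E.ι k x) = F.ι k (toFun (k + 1) x)

instance (E F : ScScale) : CoeFun (ScMap E F) (fun _ => ∀ k, E.lev k → F.lev k) := ⟨ScMap.toFun⟩

namespace ScMap

variable {E F : ScScale}

/-- `Tf` is the tangent map `(x, ξ) ↦ (f x, df(x) ξ)` of `f`: at every point `x` of level `1`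
there is a bounded linear map `df(x) : E 0 → F 0` with
`‖f (x + η) - f x - df(x) η‖₀ / ‖η‖₁ → 0` as `‖η‖₁ → 0`, and `(x, ξ) ↦ (f x, df(x) ξ)` is the
scale-continuous map `Tf`. -/
structure IsTangent (f : ScMap E F) (Tf : ScMap E.tangent F.tangent) : Prop where
  base : ∀ k (x : E.lev (k + 1)) (ξ : E.lev k), (Tf k (x, ξ)).1 = f (k + 1) x
  diff : ∀ x : E.lev 1, ∃ L : E.lev 0 →L[ℝ] F.lev 0,
    (∀ ξ : E.lev 0, (Tf 0 (x, ξ)).2 = L ξ) ∧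
    (fun η : E.lev 1 => f 0 (E.ι 0 (x + η)) - f 0 (E.ι 0 x) - L (E.ι 0 η)) =o[𝓝 0]
      (fun η : E.lev 1 => η)

/-- The differential `df(x) : E k → F k` at a point `x` of level `k+1`, read off from the
tangent map. -/
def differential (Tf : ScMap E.tangent F.tangent) (k : ℕ) (x : E.lev (k + 1)) (ξ : E.lev k) :
    F.lev k :=
  (Tf k (x, ξ)).2

/-- `scⁿ` maps: `f` is `scⁿ⁺¹` if it is scale-differentiable and its tangent map is `scⁿ`. -/
def IsScC : ℕ → ∀ {E F : ScScale}, ScMap E F → Prop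
  | 0, _, _, _ => True
  | n + 1, _, _, f => ∃ Tf, IsTangent f Tf ∧ IsScC n Tf

/-- Scale-smooth maps. -/
def ScSmooth (f : ScMap E F) : Prop := ∀ n, IsScC n f

/-- For `h : ℝ × E → F`, the map `h_t = h (t, ·) : E → F`. -/
def slice (h : ScMap ((ScScale.const ℝ).prod E) F) (t : ℝ) : ScMap E F where
  toFun k e := h k (t, e)
  cont k := (h.cont k).comp (Continuous.prodMk_right t)
  comm k e := h.comm k (t, e)

end ScMap

/-- A sc-isomorphism: a linear map which restricts to a topological isomorphism on each level. -/
structure ScIso (E F : ScScale) where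
  equiv : ∀ k, E.lev k ≃L[ℝ] F.lev k
  comm : ∀ k x, equiv k (E.ι k x) = F.ι k (equiv (k + 1) x)

/-! ### Weighted Sobolev spaces -/

/-- The measure `e^{2δ|x|} dx`, so that the norm of `g` in its `L²` space is the `L²(ℝ)` norm of
`e^{δ|x|} g`. -/
noncomputable def expWeight (δ : ℝ) : Measure ℝ :=
  volume.withDensity fun x => ENNReal.ofReal (Real.exp (2 * δ * |x|))

theorem expWeight_mono {δ δ' : ℝ} (h : δ ≤ δ') : expWeight δ ≤ expWeight δ' := by
  refine withDensity_mono (Eventually.of_forall fun x => ENNReal.ofReal_le_ofReal ?_)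
  exact Real.exp_le_exp.2 (by gcongr)

/-- The inclusion of the `L²` spaces with weights `δ ≤ δ'`. -/
noncomputable def expWeightIncl {δ δ' : ℝ} (h : δ ≤ δ') :
    Lp ℝ 2 (expWeight δ') →L[ℝ] Lp ℝ 2 (expWeight δ) :=
  LinearMap.mkContinuous
    { toFun := fun f => ((Lp.memLp f).mono_measure (expWeight_mono h)).toLp f
      map_add' := fun f g => by
        rw [← MemLp.toLp_add]
        refine MemLp.toLp_congr _ _ ?_
        exact (Measure.absolutelyContinuous_of_le (expWeight_mono h)).ae_le (Lp.coeFn_add f g)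
      map_smul' := fun c f => by
        rw [RingHom.id_apply, ← MemLp.toLp_const_smul]
        refine MemLp.toLp_congr _ _ ?_
        exact (Measure.absolutelyContinuous_of_le (expWeight_mono h)).ae_le
          (Lp.coeFn_smul c f) }
    1 (fun f => by
      rw [one_mul]
      change ‖((Lp.memLp f).mono_measure (expWeight_mono h)).toLp f‖ ≤ _
      rw [Lp.norm_toLp, Lp.norm_def]
      exact ENNReal.toReal_mono (Lp.eLpNorm_ne_top f)
        (eLpNorm_mono_measure f (expWeight_mono h)))

theorem expWeightIncl_ae {δ δ' : ℝ} (h : δ ≤ δ') (f : Lp ℝ 2 (expWeight δ')) :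
    expWeightIncl h f =ᵐ[expWeight δ] f :=
  MemLp.coeFn_toLp ((Lp.memLp f).mono_measure (expWeight_mono h))

/-- Tuples `(g₀, …, g_k)` with norm `∑ᵢ ‖e^{δ|x|} gᵢ‖_{L²}`. -/
abbrev SobolevTuple (k : ℕ) (δ : ℝ) : Type :=
  PiLp 1 (fun _ : Fin (k + 1) => Lp ℝ 2 (expWeight δ))

/-- The tuples `(φ, φ', …, φ⁽ᵏ⁾)` for smooth compactly supported `φ : ℝ → ℝ`. -/
def testTuples (k : ℕ) (δ : ℝ) : Submodule ℝ (SobolevTuple k δ) where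
  carrier := {u | ∃ φ : ℝ → ℝ, ContDiff ℝ ∞ φ ∧ HasCompactSupport φ ∧
    ∀ i, u i =ᵐ[expWeight δ] iteratedDeriv (i : ℕ) φ}
  zero_mem' := by
    refine ⟨0, contDiff_const, HasCompactSupport.zero, fun i => ?_⟩
    have h0 : iteratedDeriv (i : ℕ) (0 : ℝ → ℝ) = 0 := by
      ext x
      simp
    rw [h0]
    exact Lp.coeFn_zero ℝ 2 (expWeight δ)
  add_mem' := by
    rintro u v ⟨φ, hφ, hφc, hu⟩ ⟨ψ, hψ, hψc, hv⟩
    refine ⟨φ + ψ, hφ.add hψ, hφc.add hψc, fun i => ?_⟩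
    filter_upwards [Lp.coeFn_add (u i) (v i), hu i, hv i] with x hx hux hvx
    have h1 : ((u + v) i) x = (u i + v i : Lp ℝ 2 (expWeight δ)) x := rfl
    rw [h1, hx, Pi.add_apply, hux, hvx,
      iteratedDeriv_add (hφ.contDiffAt.of_le (by exact_mod_cast le_top))
        (hψ.contDiffAt.of_le (by exact_mod_cast le_top))]
  smul_mem' := by
    rintro c u ⟨φ, hφ, hφc, hu⟩
    refine ⟨c • φ, hφ.const_smul c, hφc.smul_left (f := fun _ => c), fun i => ?_⟩
    filter_upwards [Lp.coeFn_smul c (u i), hu i] with x hx hux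
    have h1 : ((c • u) i) x = (c • u i : Lp ℝ 2 (expWeight δ)) x := rfl
    rw [h1, hx, Pi.smul_apply, hux, iteratedDeriv_const_smul_field]

/-- The weighted Sobolev space `H^{k,δ}(ℝ)`: the completion of the smooth compactly supported
functions in the norm `∑_{i ≤ k} ‖e^{δ|x|} φ⁽ⁱ⁾‖_{L²}`, realized as the closure of the isometric
image of `φ ↦ (φ, φ', …, φ⁽ᵏ⁾)`. -/
abbrev WeightedSobolev (k : ℕ) (δ : ℝ) : Type := (testTuples k δ).topologicalClosure

/-- Forget the top derivative and lower the weight. -/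
noncomputable def tupleIncl (k : ℕ) {δ δ' : ℝ} (h : δ ≤ δ') :
    SobolevTuple (k + 1) δ' →L[ℝ] SobolevTuple k δ :=
  (PiLp.continuousLinearEquiv 1 ℝ
      (fun _ : Fin (k + 1) => Lp ℝ 2 (expWeight δ))).symm.toContinuousLinearMap.comp
    (ContinuousLinearMap.pi fun i : Fin (k + 1) =>
      (expWeightIncl h).comp
        (PiLp.proj 1 (𝕜 := ℝ) (fun _ : Fin (k + 2) => Lp ℝ 2 (expWeight δ')) i.castSucc))

theorem tupleIncl_apply (k : ℕ) {δ δ' : ℝ} (h : δ ≤ δ') (u : SobolevTuple (k + 1) δ')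
    (i : Fin (k + 1)) : tupleIncl k h u i = expWeightIncl h (u i.castSucc) := rfl

theorem tupleIncl_mem (k : ℕ) {δ δ' : ℝ} (h : δ ≤ δ') (u : SobolevTuple (k + 1) δ')
    (hu : u ∈ (testTuples (k + 1) δ').topologicalClosure) :
    tupleIncl k h u ∈ (testTuples k δ).topologicalClosure := by
  refine map_mem_closure (tupleIncl k h).continuous hu ?_
  rintro v ⟨φ, hφ, hφc, hv⟩
  refine ⟨φ, hφ, hφc, fun i => ?_⟩
  rw [tupleIncl_apply]
  exact (expWeightIncl_ae h _).trans
    ((Measure.absolutelyContinuous_of_le (expWeight_mono h)).ae_le (hv i.castSucc))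

/-- The inclusion `H^{k+1,δ'}(ℝ) → H^{k,δ}(ℝ)` for `δ ≤ δ'`. -/
noncomputable def sobolevIncl (k : ℕ) {δ δ' : ℝ} (h : δ ≤ δ') :
    WeightedSobolev (k + 1) δ' →L[ℝ] WeightedSobolev k δ :=
  ((tupleIncl k h).comp (testTuples (k + 1) δ').topologicalClosure.subtypeL).codRestrict
    (testTuples k δ).topologicalClosure (fun u => tupleIncl_mem k h u u.2)

/-- The scale `E k = H^{k, δ k}(ℝ)`. -/
noncomputable abbrev sobolevScale (δ : ℕ → ℝ) (hδ : StrictMono δ) : ScScale where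
  lev k := WeightedSobolev k (δ k)
  ι k := sobolevIncl k (hδ (Nat.lt_succ_self k)).le

/-! Take test functions φ, ψ orthonormal in L², and let b_t, g_t be their translates by r = 1/t,
which run off to infinity as t ↓ 0. For t ≤ 0 let h_t be the identity. For t > 0 let h_t be the
identity on the L²-orthogonal complement of the plane spanned by b_t and g_t, and on that plane a
planar map whose differential is invertible everywhere but which has exactly two zeros, 0 and z(t) =
exp(-1/t²) g_t. Thus all differentials are surjective, and still a second branch of zeros appears at
t = 0.

Smoothness across t = 0 is where the scale enters. In E_k the vector b_t grows like exp(δ_k r),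
while pairing with b_t decays like exp(-δ_k r). On a fixed level the projections e ↦ ⟨e, b_t⟩ b_t
are therefore only bounded, and they tend to 0 pointwise because they eventually kill each test
function. As operators from E_{k+1} to E_k they decay like exp(-(δ_{k+1} - δ_k) r) with all
r-derivatives, and such a function of r = 1/t extends smoothly by 0 to t ≤ 0
(`contDiff_rankOneSucc`). This is what sc-differentiability asks for. The tangent map consists of
the same family and a levelwise smooth term, so induction gives every order (`isLevelScC_family`).
The remaining part of h carries factors exp(-1/t²), which beat every exp(δ_k / t), so it is
classically smooth on each level (`contDiff_nonlin`).

The planar map is a disguised complex power. Put Q = 2Y - s and w = s + iQ with s > 0. Then -e^X w⁴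
- 4s⁴ has real part `planeFst` and imaginary part 4s times `planeSnd`. Since w stays in the right
half plane, the Jacobian is positive (`plane_det_pos`). There w⁴ is a negative real number only for
Q = ±s, where w⁴ = -4s⁴ and hence X = 0; so the zeros are (X, Y) = (0, 0) and (0, s)
(`eq_of_plane_eq_zero`). It is used with X = ζ⟨e, b_t⟩, Y = ζ⟨e, g_t⟩, ζ = exp(-1/t²) and s = ζ².

Surjectivity is a 2 × 2 linear system. Its solution differs from the right-hand side by multiples of
b_t and g_t, which lie in every level, so one computation in E_0 serves all E_k
(`exists_branchDeriv_eq`). -/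

/-! ### Levelwise scale calculus -/

/-- The scale `(E (k+1))ₖ`. -/
noncomputable abbrev ScScale.shift (E : ScScale) : ScScale where
  lev k := E.lev (k + 1)
  ι k := E.ι (k + 1)

/-- The inclusion of level `k` into level `0`. -/
noncomputable def ScScale.inclZero (E : ScScale) : ∀ k : ℕ, E.lev k →L[ℝ] E.lev 0
  | 0 => ContinuousLinearMap.id ℝ (E.lev 0)
  | k + 1 => (E.inclZero k).comp (E.ι k)

theorem ScScale.inclZero_succ (E : ScScale) (k : ℕ) (x : E.lev (k + 1)) :
    E.inclZero (k + 1) x = E.inclZero k (E.ι k x) := rfl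

/-- Lets equations on level k be checked after inclusion into level 0. -/
theorem ScScale.IsScBanach.inclZero_injective {E : ScScale} (hE : E.IsScBanach) (k : ℕ) :
    Function.Injective (E.inclZero k) := by
  induction k with
  | zero => exact fun _ _ h => h
  | succ k ih => exact ih.comp (hE.injective k)

/-- Scale-linear maps: bounded linear maps on every level, compatible with the inclusions. -/
structure ScLin (E F : ScScale) where
  lin : ∀ k, E.lev k →L[ℝ] F.lev k
  comm : ∀ k x, lin k (E.ι k x) = F.ι k (lin (k + 1) x)

namespace ScLin

variable {E F : ScScale}

/-- A scale-linear map as a scale-continuous map. -/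
def toScMap (L : ScLin E F) : ScMap E F where
  toFun k := L.lin k
  cont k := (L.lin k).continuous
  comm := L.comm

/-- The tangent map of a scale-linear map. -/
noncomputable def tangent (L : ScLin E F) : ScLin E.tangent F.tangent where
  lin k := (L.lin (k + 1)).prodMap (L.lin k)
  comm k x := Prod.ext (L.comm (k + 1) x.1) (L.comm k x.2)

end ScLin

namespace ScMap

variable {E F G : ScScale}

/-- Composition of scale-continuous maps. -/
def comp (g : ScMap F G) (f : ScMap E F) : ScMap E G where
  toFun k := g k ∘ f k
  cont k := (g.cont k).comp (f.cont k)
  comm k x := by simp [f.comm, g.comm]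

/-- The map `x ↦ (f x, g x)`. -/
def prodMk (f : ScMap E F) (g : ScMap E G) : ScMap E (F.prod G) where
  toFun k x := (f k x, g k x)
  cont k := (f.cont k).prodMk (g.cont k)
  comm k x := Prod.ext (f.comm k x) (g.comm k x)

/-- The pointwise sum of scale-continuous maps. -/
def add (f g : ScMap E F) : ScMap E F where
  toFun k x := f k x + g k x
  cont k := (f.cont k).add (g.cont k)
  comm k x := by simp [f.comm, g.comm]

/-- The restriction of a scale-continuous map to the shifted scales. -/
def shift (f : ScMap E F) : ScMap E.shift F.shift where
  toFun k := f (k + 1)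
  cont k := f.cont (k + 1)
  comm k := f.comm (k + 1)

theorem inclZero_apply (f : ScMap E F) (k : ℕ) (x : E.lev k) :
    F.inclZero k (f k x) = f 0 (E.inclZero k x) := by
  induction k with
  | zero => rfl
  | succ k ih => rw [F.inclZero_succ, ← f.comm, ih, E.inclZero_succ]

/-- `Tf` is the tangent map of `f`, with the differentiability property on every level. -/
structure IsLevelTangent (f : ScMap E F) (Tf : ScMap E.tangent F.tangent) : Prop where
  base : ∀ k (x : E.lev (k + 1)) (ξ : E.lev k), (Tf k (x, ξ)).1 = f (k + 1) x
  diff : ∀ k (x : E.lev (k + 1)), ∃ L : E.lev k →L[ℝ] F.lev k,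
    (∀ ξ : E.lev k, (Tf k (x, ξ)).2 = L ξ) ∧
    HasFDerivAt (fun y : E.lev (k + 1) => f k (E.ι k y)) (L.comp (E.ι k)) x

/-- `n` times scale-differentiable maps, with the differentiability property on every level. -/
def IsLevelScC : ℕ → ∀ {E F : ScScale}, ScMap E F → Prop
  | 0, _, _, _ => True
  | n + 1, _, _, f => ∃ Tf, IsLevelTangent f Tf ∧ IsLevelScC n Tf

theorem IsLevelTangent.isTangent {f : ScMap E F} {Tf : ScMap E.tangent F.tangent}
    (h : IsLevelTangent f Tf) : IsTangent f Tf := by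
  refine ⟨h.base, fun x => ?_⟩
  obtain ⟨L, hL, hd⟩ := h.diff 0 x
  exact ⟨L, hL, hasFDerivAt_iff_isLittleO_nhds_zero.1 hd⟩

theorem IsLevelScC.isScC {n : ℕ} : ∀ {E F : ScScale} {f : ScMap E F}, IsLevelScC n f →
    IsScC n f := by
  induction n with
  | zero => exact fun _ => trivial
  | succ n ih =>
    rintro E F f ⟨Tf, h, h'⟩
    exact ⟨Tf, h.isTangent, ih h'⟩

/-- The tangent of a linear map is again linear, so the induction closes. Together with `lin_comp`
this replaces the general chain rule: every composition needed below has a linear factor. -/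
theorem IsLevelScC.comp_lin {n : ℕ} : ∀ {E F G : ScScale} {f : ScMap F G} (L : ScLin E F),
    IsLevelScC n f → IsLevelScC n (f.comp L.toScMap) := by
  induction n with
  | zero => exact fun _ _ => trivial
  | succ n ih =>
    rintro E F G f L ⟨Tf, h, h'⟩
    refine ⟨Tf.comp L.tangent.toScMap, ⟨fun k x ξ => h.base k _ _, fun k x => ?_⟩, ih _ h'⟩
    obtain ⟨M, hM, hd⟩ := h.diff k (L.lin (k + 1) x)
    refine ⟨M.comp (L.lin k), fun ξ => hM _, ?_⟩
    have := hd.comp x (L.lin (k + 1)).hasFDerivAt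
    refine (this.congr_fderiv ?_).congr_of_eventuallyEq (Eventually.of_forall fun y => ?_)
    · ext ξ
      simp [L.comm]
    · simp [comp, ScLin.toScMap, L.comm]

theorem IsLevelScC.lin_comp {n : ℕ} : ∀ {E F G : ScScale} {f : ScMap E F} (L : ScLin F G),
    IsLevelScC n f → IsLevelScC n (L.toScMap.comp f) := by
  induction n with
  | zero => exact fun _ _ => trivial
  | succ n ih =>
    rintro E F G f L ⟨Tf, h, h'⟩
    refine ⟨L.tangent.toScMap.comp Tf,
      ⟨fun k x ξ => congrArg (L.lin (k + 1)) (h.base k x ξ), fun k x => ?_⟩, ih _ h'⟩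
    obtain ⟨M, hM, hd⟩ := h.diff k x
    exact ⟨(L.lin k).comp M, fun ξ => congrArg (L.lin k) (hM ξ),
      (L.lin k).hasFDerivAt.comp x hd⟩

/-- The rearrangement `TF × TG → T(F × G)`. -/
noncomputable def tangentProd (F G : ScScale) :
    ScLin (F.tangent.prod G.tangent) (F.prod G).tangent where
  lin _ := ContinuousLinearMap.prod
    (((ContinuousLinearMap.fst ℝ _ _).comp (ContinuousLinearMap.fst ℝ _ _)).prod
      ((ContinuousLinearMap.fst ℝ _ _).comp (ContinuousLinearMap.snd ℝ _ _)))
    (((ContinuousLinearMap.snd ℝ _ _).comp (ContinuousLinearMap.fst ℝ _ _)).prod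
      ((ContinuousLinearMap.snd ℝ _ _).comp (ContinuousLinearMap.snd ℝ _ _)))
  comm _ _ := rfl

theorem IsLevelScC.prodMk {n : ℕ} : ∀ {E F G : ScScale} {f : ScMap E F} {g : ScMap E G},
    IsLevelScC n f → IsLevelScC n g → IsLevelScC n (f.prodMk g) := by
  induction n with
  | zero => exact fun _ _ => trivial
  | succ n ih =>
    rintro E F G f g ⟨Tf, hf, hf'⟩ ⟨Tg, hg, hg'⟩
    refine ⟨(tangentProd F G).toScMap.comp (Tf.prodMk Tg),
      ⟨fun k x ξ => Prod.ext (hf.base k x ξ) (hg.base k x ξ), fun k x => ?_⟩,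
      (ih hf' hg').lin_comp _⟩
    obtain ⟨M, hM, hMd⟩ := hf.diff k x
    obtain ⟨N, hN, hNd⟩ := hg.diff k x
    exact ⟨M.prod N, fun ξ => Prod.ext (hM ξ) (hN ξ), hMd.prodMk hNd⟩

theorem IsLevelScC.add {n : ℕ} {f g : ScMap E F} (hf : IsLevelScC n f) (hg : IsLevelScC n g) :
    IsLevelScC n (f.add g) := by
  let L : ScLin (F.prod F) F :=
    { lin := fun k => ContinuousLinearMap.fst ℝ _ _ + ContinuousLinearMap.snd ℝ _ _
      comm := fun k x => by simp }
  exact (hf.prodMk hg).lin_comp L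

/-- This is the reason for demanding differentiability on every level: a condition on level 0 alone
says nothing about the shifted map, which occurs in the tangent map in `isLevelScC_family`. -/
theorem IsLevelScC.shift {n : ℕ} : ∀ {E F : ScScale} {f : ScMap E F},
    IsLevelScC n f → IsLevelScC n f.shift := by
  induction n with
  | zero => exact fun _ => trivial
  | succ n ih =>
    rintro E F f ⟨Tf, h, h'⟩
    exact ⟨Tf.shift, ⟨fun k => h.base (k + 1), fun k => h.diff (k + 1)⟩, ih h'⟩

/-- The tangent map of a levelwise smooth map. -/
noncomputable def levelTangent (f : ScMap E F) (hf : ∀ k, ContDiff ℝ ∞ (f k)) :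
    ScMap E.tangent F.tangent where
  toFun k x := (f (k + 1) x.1, fderiv ℝ (f k) (E.ι k x.1) x.2)
  cont k := by
    have h1 := (hf k).continuous_fderiv (by simp)
    have h2 := f.cont (k + 1)
    fun_prop
  comm k x := by
    refine Prod.ext (f.comm _ _) ?_
    -- Differentiate both sides of f ∘ ι = ι ∘ f.
    have h1 := (((hf k).differentiable (by simp)) (E.ι k (E.ι (k + 1) x.1))).hasFDerivAt.comp _
      (E.ι k).hasFDerivAt
    have h2 := (F.ι k).hasFDerivAt.comp _
      (((hf (k + 1)).differentiable (by simp)) (E.ι (k + 1) x.1)).hasFDerivAt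
    have h3 : f k ∘ E.ι k = F.ι k ∘ f (k + 1) := funext (f.comm k)
    rw [h3] at h1
    exact DFunLike.congr_fun (h1.unique h2) x.2

theorem isLevelScC_of_contDiff {n : ℕ} : ∀ {E F : ScScale} {f : ScMap E F},
    (∀ k, ContDiff ℝ ∞ (f k)) → IsLevelScC n f := by
  induction n with
  | zero => exact fun _ => trivial
  | succ n ih =>
    intro E F f hf
    refine ⟨f.levelTangent hf,
      ⟨fun _ _ _ => rfl, fun k x => ⟨fderiv ℝ (f k) (E.ι k x), fun _ => rfl, ?_⟩⟩,
      ih fun k => ?_⟩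
    · exact (((hf k).differentiable (by simp)) (E.ι k x)).hasFDerivAt.comp _
        (E.ι k).hasFDerivAt
    · have h1 : ContDiff ℝ ∞ (fderiv ℝ (f k)) := (hf k).fderiv_right (by simp)
      have h2 := hf (k + 1)
      have h3 : ContDiff ℝ ∞ (fun x : E.lev (k + 1) × E.lev k => f (k + 1) x.1) :=
        h2.comp contDiff_fst
      have h4 : ContDiff ℝ ∞ (fun x : E.lev (k + 1) × E.lev k =>
          fderiv ℝ (f k) (E.ι k x.1) x.2) :=
        (h1.comp ((E.ι k).contDiff.comp contDiff_fst)).clm_apply contDiff_snd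
      exact h3.prodMk h4

/-- A family of linear maps `P t : E k → E k` whose derivative `Q t : E (k+1) → E k` is levelwise
smooth is scale-smooth. -/
theorem isLevelScC_family {E : ScScale} (P : ScMap ((ScScale.const ℝ).prod E) E)
    (A : ∀ k, ℝ → E.lev k →L[ℝ] E.lev k) (hA : ∀ k t e, P k (t, e) = A k t e)
    (Q : ScMap ((ScScale.const ℝ).prod E.shift) E) (hQ : ∀ k, ContDiff ℝ ∞ (Q k))
    (hd : ∀ k t (e : E.lev (k + 1)), HasFDerivAt
      (fun y : ℝ × E.lev (k + 1) => P k (y.1, E.ι k y.2))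
      (((A k t).comp (E.ι k)).comp (ContinuousLinearMap.snd ℝ ℝ _) +
        (ContinuousLinearMap.fst ℝ ℝ _).smulRight (Q k (t, e))) (t, e)) (n : ℕ) :
    IsLevelScC n P := by
  induction n with
  | zero => trivial
  | succ n ih =>
    let pr₁ : ScLin ((ScScale.const ℝ).prod E).tangent ((ScScale.const ℝ).prod E).shift :=
      { lin := fun k => ContinuousLinearMap.fst ℝ _ _
        comm := fun _ _ => rfl }
    let pr₂ : ScLin ((ScScale.const ℝ).prod E).tangent ((ScScale.const ℝ).prod E) :=
      { lin := fun k => ((ContinuousLinearMap.fst ℝ _ _).comp (ContinuousLinearMap.fst ℝ _ _)).prod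
          ((ContinuousLinearMap.snd ℝ _ _).comp (ContinuousLinearMap.snd ℝ _ _))
        comm := fun _ _ => rfl }
    let S : ScMap ((ScScale.const ℝ).prod E).tangent E :=
      { toFun := fun k y => y.2.1 • Q k y.1
        cont := fun k => by
          have := Q.cont k
          fun_prop
        comm := fun k y => by
          rw [map_smul, ← Q.comm]
          rfl }
    have hS : ∀ k, ContDiff ℝ ∞ (S k) := fun k =>
      (contDiff_fst.comp contDiff_snd).smul ((hQ k).comp contDiff_fst)
    -- The tangent map is ((t, e), (T, X)) ↦ (P (t, e), P (t, X) + T • Q (t, e)): two copies of `P`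
    -- precomposed with linear maps, the first one shifted, and a levelwise smooth term. The
    -- induction hypothesis applies to both copies.
    refine ⟨(P.shift.comp pr₁.toScMap).prodMk ((P.comp pr₂.toScMap).add S),
      ⟨fun k x ξ => rfl, fun k x => ?_⟩,
      (ih.shift.comp_lin pr₁).prodMk ((ih.comp_lin pr₂).add (isLevelScC_of_contDiff hS))⟩
    refine ⟨(A k x.1).comp (ContinuousLinearMap.snd ℝ ℝ _) +
      (ContinuousLinearMap.fst ℝ ℝ _).smulRight (Q k (x.1, x.2)), fun ξ => ?_, ?_⟩
    · rw [_root_.add_apply, ContinuousLinearMap.comp_apply, ← hA]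
      rfl
    · refine (hd k x.1 x.2).congr_fderiv ?_
      ext ξ <;> rfl

/-- The tangent map of a slice. -/
noncomputable def sliceTangent (Th : ScMap ((ScScale.const ℝ).prod E).tangent F.tangent) (t : ℝ) :
    ScMap E.tangent F.tangent where
  toFun k y := Th k ((t, y.1), (0, y.2))
  cont k := (Th.cont k).comp (by fun_prop)
  comm k y := Th.comm k ((t, y.1), (0, y.2))

theorem IsLevelTangent.slice {h : ScMap ((ScScale.const ℝ).prod E) F}
    {Th : ScMap ((ScScale.const ℝ).prod E).tangent F.tangent} (hT : IsLevelTangent h Th) (t : ℝ) :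
    IsLevelTangent (h.slice t) (Th.sliceTangent t) := by
  refine ⟨fun k x ξ => hT.base k _ _, fun k x => ?_⟩
  obtain ⟨L, hL, hd⟩ := hT.diff k (t, x)
  refine ⟨L.comp (ContinuousLinearMap.inr ℝ ℝ _), fun ξ => hL _, ?_⟩
  refine (hd.comp x (hasFDerivAt_prodMk_right t x)).congr_fderiv ?_
  ext ξ
  simp

end ScMap

/-! ### Test functions in the weighted Sobolev spaces -/

/-- Smooth compactly supported functions. -/
def testFn : Submodule ℝ (ℝ → ℝ) where
  carrier := {φ | ContDiff ℝ ∞ φ ∧ HasCompactSupport φ}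
  zero_mem' := ⟨contDiff_const, HasCompactSupport.zero⟩
  add_mem' h h' := ⟨h.1.add h'.1, h.2.add h'.2⟩
  smul_mem' c _ h := ⟨h.1.const_smul c, h.2.smul_left (f := fun _ => c)⟩

/-- The type of smooth compactly supported functions. -/
abbrev TestFn : Type := testFn

namespace TestFn

theorem contDiff (φ : TestFn) : ContDiff ℝ ∞ φ.1 := φ.2.1

theorem hasCompactSupport (φ : TestFn) : HasCompactSupport φ.1 := φ.2.2

theorem continuous (φ : TestFn) : Continuous φ.1 := φ.contDiff.continuous

theorem differentiable (φ : TestFn) : Differentiable ℝ φ.1 := φ.contDiff.differentiable (by simp)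

theorem exists_support (φ : TestFn) : ∃ a > 0, ∀ x, a < |x| → φ.1 x = 0 := by
  obtain ⟨a, ha⟩ := φ.hasCompactSupport.isCompact.isBounded.subset_closedBall 0
  refine ⟨max a 1, by positivity, fun x hx => ?_⟩
  by_contra h
  have h1 := ha (subset_tsupport _ h)
  rw [mem_closedBall_zero_iff, Real.norm_eq_abs] at h1
  exact absurd (h1.trans (le_max_left _ _)) (not_le.2 hx)

theorem exists_bound (φ : TestFn) : ∃ M, 0 ≤ M ∧ ∀ x, |φ.1 x| ≤ M := by
  obtain ⟨M, hM⟩ := φ.hasCompactSupport.exists_bound_of_continuous φ.continuous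
  exact ⟨M, (norm_nonneg _).trans (hM 0), hM⟩

/-- The derivative on test functions. -/
noncomputable def derivT : Module.End ℝ TestFn where
  toFun φ := ⟨deriv φ.1, by
    have := φ.contDiff
    exact ((contDiff_infty_iff_deriv (𝕜 := ℝ)).1 this).2, φ.hasCompactSupport.deriv⟩
  map_add' φ ψ := Subtype.ext <| funext fun x =>
    deriv_add (φ.differentiable x) (ψ.differentiable x)
  map_smul' c φ := Subtype.ext <| funext fun x => deriv_const_smul c (φ.differentiable x)

theorem hasDerivAt (φ : TestFn) (x : ℝ) : HasDerivAt φ.1 ((derivT φ).1 x) x :=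
  (φ.differentiable x).hasDerivAt

theorem coe_derivT_pow (n : ℕ) (φ : TestFn) : ((derivT ^ n) φ).1 = iteratedDeriv n φ.1 := by
  induction n with
  | zero => simp
  | succ n ih =>
    rw [pow_succ', Module.End.mul_apply, iteratedDeriv_succ, ← ih]
    rfl

/-- Translation of test functions. -/
def trans (r : ℝ) : Module.End ℝ TestFn where
  toFun φ := ⟨fun x => φ.1 (x - r), φ.contDiff.comp (contDiff_id.sub contDiff_const),
    φ.hasCompactSupport.comp_homeomorph (Homeomorph.subRight r)⟩
  map_add' _ _ := rfl
  map_smul' _ _ := rfl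

theorem derivT_trans (r : ℝ) (φ : TestFn) : derivT (trans r φ) = trans r (derivT φ) :=
  Subtype.ext <| funext fun x => deriv_comp_sub_const (f := φ.1) r x

theorem derivT_pow_trans (n : ℕ) (r : ℝ) (φ : TestFn) :
    (derivT ^ n) (trans r φ) = trans r ((derivT ^ n) φ) := by
  induction n with
  | zero => simp
  | succ n ih => rw [pow_succ', Module.End.mul_apply, ih, derivT_trans, Module.End.mul_apply]

/-- The first order Taylor estimate. -/
theorem exists_taylor_bound (φ : TestFn) :
    ∃ M, 0 ≤ M ∧ ∀ x s, |φ.1 (x + s) - φ.1 x - s * (derivT φ).1 x| ≤ M * s ^ 2 := by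
  obtain ⟨M, hM0, hM⟩ := (derivT (derivT φ)).exists_bound
  refine ⟨M, hM0, fun x s => ?_⟩
  have h1 : ∀ y, |(derivT φ).1 y - (derivT φ).1 x| ≤ M * |y - x| := fun y =>
    Convex.norm_image_sub_le_of_norm_hasDerivWithin_le
      (fun z _ => ((derivT φ).hasDerivAt z).hasDerivWithinAt) (fun z _ => hM z) convex_univ
      (Set.mem_univ x) (Set.mem_univ y)
  -- Mean value inequality for z ↦ φ z - z φ'(x), whose derivative is at most M|s| between x and x +
  -- s.
  have h2 := Convex.norm_image_sub_le_of_norm_hasDerivWithin_le (C := M * |s|)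
    (f := fun z => φ.1 z - z * (derivT φ).1 x) (s := Set.uIcc x (x + s)) (x := x) (y := x + s)
    (fun z _ => ((φ.hasDerivAt z).sub ((hasDerivAt_id z).mul_const _)).hasDerivWithinAt)
    (fun z hz => by
      rw [one_mul]
      refine (h1 z).trans ?_
      have := Set.abs_sub_left_of_mem_uIcc hz
      rw [add_sub_cancel_left] at this
      gcongr) (convex_uIcc _ _) Set.left_mem_uIcc Set.right_mem_uIcc
  rw [Real.norm_eq_abs, Real.norm_eq_abs, add_sub_cancel_left, mul_assoc, abs_mul_abs_self] at h2
  rw [pow_two]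
  convert h2 using 2
  ring

end TestFn

/-! ### Weighted norms of test functions and differentiability of translation -/

instance (δ : ℝ) : IsLocallyFiniteMeasure (expWeight δ) :=
  IsLocallyFiniteMeasure.withDensity_ofReal (by fun_prop)

theorem expWeight_zero : expWeight 0 = volume := by
  simp [expWeight]

theorem expWeight_ac (δ : ℝ) : expWeight δ ≪ volume := withDensity_absolutelyContinuous _ _

theorem ac_expWeight (δ : ℝ) : volume ≪ expWeight δ :=
  withDensity_absolutelyContinuous' (by fun_prop) (Eventually.of_forall fun x => by positivity)

theorem expWeight_restrict_le {δ d : ℝ} {K : Set ℝ} (hK : MeasurableSet K)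
    (h : ∀ x ∈ K, δ * |x| ≤ d) :
    (expWeight δ).restrict K ≤ ENNReal.ofReal (Real.exp (2 * d)) • volume.restrict K := by
  rw [expWeight, restrict_withDensity hK, ← withDensity_const]
  refine withDensity_mono ((ae_restrict_iff' hK).2 (Eventually.of_forall fun x hx => ?_))
  refine ENNReal.ofReal_le_ofReal (Real.exp_le_exp.2 ?_)
  linarith [h x hx]

theorem le_expWeight_restrict {δ d : ℝ} {K : Set ℝ} (hK : MeasurableSet K)
    (h : ∀ x ∈ K, d ≤ δ * |x|) :
    ENNReal.ofReal (Real.exp (2 * d)) • volume.restrict K ≤ (expWeight δ).restrict K := by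
  rw [expWeight, restrict_withDensity hK, ← withDensity_const]
  refine withDensity_mono ((ae_restrict_iff' hK).2 (Eventually.of_forall fun x hx => ?_))
  refine ENNReal.ofReal_le_ofReal (Real.exp_le_exp.2 ?_)
  linarith [h x hx]

namespace TestFn

theorem memLp (φ : TestFn) (δ : ℝ) : MemLp φ.1 2 (expWeight δ) :=
  φ.continuous.memLp_of_hasCompactSupport φ.hasCompactSupport

/-- Test functions as elements of the weighted `L²` space. -/
noncomputable def toL2 (δ : ℝ) : TestFn →ₗ[ℝ] Lp ℝ 2 (expWeight δ) where
  toFun φ := (φ.memLp δ).toLp φ.1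
  map_add' _ _ := rfl
  map_smul' _ _ := rfl

theorem toL2_ae (δ : ℝ) (φ : TestFn) : toL2 δ φ =ᵐ[expWeight δ] φ.1 :=
  MemLp.coeFn_toLp (φ.memLp δ)

theorem expWeightIncl_toL2 {δ δ' : ℝ} (h : δ ≤ δ') (φ : TestFn) :
    expWeightIncl h (toL2 δ' φ) = toL2 δ φ := by
  refine Lp.ext ((expWeightIncl_ae h _).trans (EventuallyEq.trans ?_ (toL2_ae δ φ).symm))
  exact (Measure.absolutelyContinuous_of_le (expWeight_mono h)).ae_le (toL2_ae δ' φ)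

theorem norm_toL2_le {δ d M a b : ℝ} (φ : TestFn) (hM0 : 0 ≤ M) (hM : ∀ x, |φ.1 x| ≤ M)
    (hs : ∀ x, x ∉ Set.Icc a b → φ.1 x = 0) (hd : ∀ x ∈ Set.Icc a b, δ * |x| ≤ d) :
    ‖toL2 δ φ‖ ≤ Real.sqrt (b - a) * Real.exp d * M := by
  have h1 : ‖toL2 δ φ‖ = (eLpNorm φ.1 2 (expWeight δ)).toReal := Lp.norm_toLp _ (φ.memLp δ)
  have h2 : eLpNorm φ.1 2 (expWeight δ) = eLpNorm φ.1 2 ((expWeight δ).restrict (Set.Icc a b)) :=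
    (eLpNorm_restrict_eq_of_support_subset fun x hx => by_contra fun h => hx (hs x h)).symm
  have h3 := eLpNorm_le_of_ae_bound (p := 2) (μ := (expWeight δ).restrict (Set.Icc a b))
    (f := φ.1) (C := M) (Eventually.of_forall hM)
  have h4 : (expWeight δ).restrict (Set.Icc a b) Set.univ ≤
      ENNReal.ofReal (Real.exp (2 * d) * (b - a)) := by
    refine (expWeight_restrict_le measurableSet_Icc hd Set.univ).trans ?_
    rw [ENNReal.ofReal_mul (by positivity)]
    simp
  rw [h1, h2]
  refine ENNReal.toReal_le_of_le_ofReal (by positivity) (h3.trans ?_)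
  rw [ENNReal.ofReal_mul (by positivity)]
  gcongr
  refine (ENNReal.rpow_le_rpow h4 (by simp)).trans ?_
  rcases le_total a b with hab | hab
  · rw [ENNReal.ofReal_rpow_of_nonneg (mul_nonneg (by positivity) (by linarith)) (by simp)]
    refine ENNReal.ofReal_le_ofReal (le_of_eq ?_)
    rw [show ((2 : ℝ≥0∞).toReal)⁻¹ = (1 / 2 : ℝ) by norm_num, ← Real.sqrt_eq_rpow,
      Real.sqrt_mul (by positivity), mul_comm, two_mul, Real.exp_add,
      Real.sqrt_mul_self (by positivity)]
  · rw [ENNReal.ofReal_of_nonpos (mul_nonpos_of_nonneg_of_nonpos (by positivity) (by linarith))]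
    simp

/-- Translates grow at most like the weight. -/
theorem exists_norm_toL2_trans_le {δ : ℝ} (hδ : 0 ≤ δ) (φ : TestFn) :
    ∃ C, ∀ r, 0 ≤ r → ‖toL2 δ (trans r φ)‖ ≤ C * Real.exp (δ * r) := by
  obtain ⟨a, ha, hs⟩ := φ.exists_support
  obtain ⟨M, hM0, hM⟩ := φ.exists_bound
  refine ⟨Real.sqrt (2 * a) * Real.exp (δ * a) * M, fun r hr => ?_⟩
  refine (norm_toL2_le (d := δ * (r + a)) (a := r - a) (b := r + a) (trans r φ) hM0
    (fun x => hM _) (fun x hx => hs _ ?_) fun x hx => ?_).trans (le_of_eq ?_)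
  · contrapose! hx
    rw [abs_le] at hx
    constructor <;> linarith
  · gcongr
    rw [abs_le]
    constructor <;> linarith [hx.1, hx.2]
  · rw [mul_add, Real.exp_add]
    ring_nf

theorem hasDerivAt_toL2_trans (δ : ℝ) (φ : TestFn) (r : ℝ) :
    HasDerivAt (fun r => toL2 δ (trans r φ)) (-toL2 δ (trans r (derivT φ))) r := by
  obtain ⟨a, ha, hs⟩ := φ.exists_support
  obtain ⟨a', ha', hs'⟩ := (derivT φ).exists_support
  obtain ⟨M, hM0, hM⟩ := φ.exists_taylor_bound
  -- For |s| ≤ 1 all the translates involved are supported in [-c, c], so one constant serves all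
  -- increments.
  set c := |r| + a + a' + 1
  have hc : 0 ≤ c := by positivity
  rw [hasDerivAt_iff_isLittleO_nhds_zero]
  have key : ∀ s : ℝ, |s| ≤ 1 → ‖toL2 δ (trans (r + s) φ) - toL2 δ (trans r φ) -
      s • -toL2 δ (trans r (derivT φ))‖ ≤
      (Real.sqrt (c - -c) * Real.exp (|δ| * c) * M) * ‖s ^ 2‖ := by
    intro s hsm
    rw [show toL2 δ (trans (r + s) φ) - toL2 δ (trans r φ) -
      s • -toL2 δ (trans r (derivT φ)) = toL2 δ (trans (r + s) φ - trans r φ +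
        s • trans r (derivT φ)) by simp]
    have hval : ∀ x, (trans (r + s) φ - trans r φ + s • trans r (derivT φ)).1 x =
        φ.1 (x - r + -s) - φ.1 (x - r) - -s * (derivT φ).1 (x - r) := by
      intro x
      have : (trans (r + s) φ - trans r φ + s • trans r (derivT φ)).1 x =
        φ.1 (x - (r + s)) - φ.1 (x - r) + s * (derivT φ).1 (x - r) := rfl
      rw [this]
      ring_nf
    refine (norm_toL2_le (a := -c) (b := c) (M := M * s ^ 2) (d := |δ| * c) _ (by positivity)
      (fun x => ?_) (fun x hx => ?_) (fun x hx => ?_)).trans (le_of_eq ?_)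
    · rw [hval]
      simpa using hM (x - r) (-s)
    · have hx : c < |x| := by
        by_contra! h
        exact hx (abs_le.1 h)
      have h1 : |x| ≤ |x - r| + |r| := by simpa using abs_add_le (x - r) r
      have h2 : |x| ≤ |x - r + -s| + |r| + |s| := by
        have h3 := abs_add_le (x - r + -s) (r + s)
        rw [show x - r + -s + (r + s) = x by ring] at h3
        linarith [abs_add_le r s]
      rw [hval, hs (x - r) (by linarith), hs' (x - r) (by linarith), hs _ (by linarith)]
      simp
    · have := abs_le.2 hx
      gcongr
      exact le_abs_self δ
    · rw [Real.norm_eq_abs, abs_of_nonneg (by positivity : 0 ≤ s ^ 2)]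
      ring
  have hO : (fun s : ℝ => toL2 δ (trans (r + s) φ) - toL2 δ (trans r φ) -
      s • -toL2 δ (trans r (derivT φ))) =O[𝓝 0] fun s => s ^ 2 := by
    refine IsBigO.of_bound (Real.sqrt (c - -c) * Real.exp (|δ| * c) * M) ?_
    filter_upwards [Metric.closedBall_mem_nhds (0 : ℝ) one_pos] with s hs
    exact key s (by simpa using hs)
  exact hO.trans_isLittleO (isLittleO_pow_id one_lt_two)

/-- Test functions as elements of the weighted Sobolev space. -/
noncomputable def toSob (k : ℕ) (δ : ℝ) : TestFn →ₗ[ℝ] WeightedSobolev k δ where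
  toFun φ := ⟨WithLp.toLp 1 fun i : Fin (k + 1) => toL2 δ ((derivT ^ (i : ℕ)) φ),
    subset_closure ⟨φ.1, φ.contDiff, φ.hasCompactSupport, fun i => by
      rw [← coe_derivT_pow]
      exact toL2_ae δ _⟩⟩
  map_add' φ ψ := by
    refine Subtype.ext (PiLp.ext fun i => ?_)
    simp
  map_smul' c φ := by
    refine Subtype.ext (PiLp.ext fun i => ?_)
    simp

theorem toSob_apply (k : ℕ) (δ : ℝ) (φ : TestFn) (i : Fin (k + 1)) :
    (toSob k δ φ).1 i = toL2 δ ((derivT ^ (i : ℕ)) φ) := rfl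

theorem norm_sobolev {k : ℕ} {δ : ℝ} (u : WeightedSobolev k δ) : ‖u‖ = ∑ i, ‖u.1 i‖ :=
  PiLp.norm_eq_of_L1 u.1

theorem sobolevIncl_toSob (k : ℕ) {δ δ' : ℝ} (h : δ ≤ δ') (φ : TestFn) :
    sobolevIncl k h (toSob (k + 1) δ' φ) = toSob k δ φ :=
  Subtype.ext <| PiLp.ext fun _ => expWeightIncl_toL2 h _

theorem exists_eq_toSob {k : ℕ} {δ : ℝ} {u : SobolevTuple k δ} (hu : u ∈ testTuples k δ) :
    ∃ φ : TestFn, (toSob k δ φ).1 = u := by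
  obtain ⟨φ, h, h', hφ⟩ := hu
  refine ⟨⟨φ, h, h'⟩, PiLp.ext fun i => Lp.ext ?_⟩
  rw [toSob_apply]
  refine (toL2_ae δ _).trans ?_
  rw [coe_derivT_pow]
  exact (hφ i).symm

theorem denseRange_toSob (k : ℕ) (δ : ℝ) : DenseRange (toSob k δ) := by
  intro u
  rw [closure_subtype]
  refine closure_mono ?_ u.2
  intro v hv
  obtain ⟨φ, hφ⟩ := exists_eq_toSob hv
  exact ⟨toSob k δ φ, ⟨φ, rfl⟩, hφ⟩

theorem exists_norm_toSob_trans_le (k : ℕ) {δ : ℝ} (hδ : 0 ≤ δ) (φ : TestFn) :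
    ∃ C, ∀ r, 0 ≤ r → ‖toSob k δ (trans r φ)‖ ≤ C * Real.exp (δ * r) := by
  choose C hC using fun i : Fin (k + 1) =>
    exists_norm_toL2_trans_le hδ ((derivT ^ (i : ℕ)) φ)
  refine ⟨∑ i, C i, fun r hr => ?_⟩
  rw [norm_sobolev, Finset.sum_mul]
  refine Finset.sum_le_sum fun i _ => ?_
  rw [toSob_apply, derivT_pow_trans]
  exact hC i r hr

theorem hasDerivAt_toSob_trans (k : ℕ) (δ : ℝ) (φ : TestFn) (r : ℝ) :
    HasDerivAt (fun r => toSob k δ (trans r φ)) (-toSob k δ (trans r (derivT φ))) r := by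
  rw [hasDerivAt_iff_isLittleO_nhds_zero, ← isLittleO_norm_left]
  simp_rw [norm_sobolev]
  refine IsLittleO.fun_sum fun i _ => ?_
  rw [isLittleO_norm_left]
  have := hasDerivAt_iff_isLittleO_nhds_zero.1
    (hasDerivAt_toL2_trans δ ((derivT ^ (i : ℕ)) φ) r)
  refine this.congr_left fun s => ?_
  have hc : (derivT ^ (i : ℕ)) (derivT φ) = derivT ((derivT ^ (i : ℕ)) φ) := by
    rw [← Module.End.mul_apply, ← Module.End.mul_apply, ← pow_succ, ← pow_succ']
  rw [← derivT_pow_trans, ← derivT_pow_trans, ← hc, ← derivT_pow_trans]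
  rfl

theorem inner_toL2 {δ : ℝ} (f : Lp ℝ 2 (expWeight δ)) (φ : TestFn) :
    inner ℝ (toL2 δ φ) f = ∫ x, φ.1 x * f x ∂(expWeight δ) := by
  rw [L2.inner_def]
  refine integral_congr_ae ?_
  filter_upwards [toL2_ae δ φ] with x hx
  rw [hx]
  simp [mul_comm]

end TestFn

/-! ### Weak derivatives, density of test functions, and pairings with far translates -/

theorem integral_expWeight_zero (g : ℝ → ℝ) : ∫ x, g x ∂(expWeight 0) = ∫ x, g x := by
  rw [expWeight_zero]

theorem eLpNorm_expWeight_zero (g : ℝ → ℝ) (K : Set ℝ) :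
    eLpNorm g 2 ((expWeight 0).restrict K) = eLpNorm g 2 (volume.restrict K) := by
  rw [expWeight_zero]

theorem locallyIntegrable_expWeight_zero {g : ℝ → ℝ} (h : LocallyIntegrable g (expWeight 0)) :
    LocallyIntegrable g volume := by
  rwa [expWeight_zero] at h

namespace TestFn

theorem integral_derivT_mul (φ ψ : TestFn) :
    ∫ x, (derivT φ).1 x * ψ.1 x = -∫ x, φ.1 x * (derivT ψ).1 x := by
  have hi : ∀ φ ψ : TestFn, Integrable (φ.1 * ψ.1) := fun φ ψ =>
    (φ.continuous.mul ψ.continuous).integrable_of_hasCompactSupport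
      φ.hasCompactSupport.mul_right
  have := integral_mul_deriv_eq_deriv_mul_of_integrable (fun x _ => φ.hasDerivAt x)
    (fun x _ => ψ.hasDerivAt x) (hi _ _) (hi _ _) (hi _ _)
  rw [this, neg_neg]

theorem inner_toL2_toL2 (φ ψ : TestFn) :
    inner ℝ (toL2 0 φ) (toL2 0 ψ) = ∫ x, φ.1 x * ψ.1 x := by
  rw [inner_toL2, integral_expWeight_zero]
  have h := toL2_ae 0 ψ
  refine integral_congr_ae ?_
  filter_upwards [(ac_expWeight 0).ae_le h] with x hx
  rw [hx]

/-- The components of an element of a weighted Sobolev space are weak derivatives of each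
other. -/
theorem inner_derivT {k : ℕ} {δ : ℝ} (hδ : 0 ≤ δ) (u : WeightedSobolev (k + 1) δ)
    (i : Fin (k + 1)) (φ : TestFn) :
    inner ℝ (toL2 0 (derivT φ)) (expWeightIncl hδ (u.1 i.castSucc)) =
      -inner ℝ (toL2 0 φ) (expWeightIncl hδ (u.1 i.succ)) := by
  refine DenseRange.induction_on (denseRange_toSob (k + 1) δ) u ?_ fun ψ => ?_
  · have hc : ∀ j, Continuous fun u : WeightedSobolev (k + 1) δ => expWeightIncl hδ (u.1 j) :=
      fun j => (expWeightIncl hδ).continuous.comp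
        ((PiLp.continuous_apply _ _ j).comp continuous_subtype_val)
    exact isClosed_eq (continuous_const.inner (hc _)) (continuous_const.inner (hc _)).neg
  · rw [toSob_apply, toSob_apply, expWeightIncl_toL2, expWeightIncl_toL2, inner_toL2_toL2,
      inner_toL2_toL2, integral_derivT_mul, Fin.val_succ, pow_succ', Module.End.mul_apply]
    rfl

theorem eq_zero_of_inner_eq_zero {δ : ℝ} (hδ : 0 ≤ δ) (f : Lp ℝ 2 (expWeight δ))
    (h : ∀ φ, inner ℝ (toL2 0 φ) (expWeightIncl hδ f) = 0) : f = 0 := by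
  have h0 : ∀ᵐ x, (expWeightIncl hδ f : ℝ → ℝ) x = 0 := by
    refine ae_eq_zero_of_integral_contDiff_smul_eq_zero ?_ fun g hg hg' => ?_
    · exact locallyIntegrable_expWeight_zero
        ((Lp.memLp (expWeightIncl hδ f)).locallyIntegrable (by norm_num))
    · have := h ⟨g, hg, hg'⟩
      rwa [inner_toL2, integral_expWeight_zero] at this
  refine (Lp.eq_zero_iff_ae_eq_zero).2 ((expWeight_ac δ).ae_le ?_)
  have h1 := (ac_expWeight 0).ae_le (expWeightIncl_ae hδ f)
  filter_upwards [h0, h1] with x hx hx'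
  rw [← hx', hx]
  rfl

theorem expWeightIncl_injective {δ δ' : ℝ} (h : δ ≤ δ') :
    Function.Injective (expWeightIncl h) := by
  rw [injective_iff_map_eq_zero]
  intro f hf
  refine (Lp.eq_zero_iff_ae_eq_zero).2 ((expWeight_ac δ').ae_le ?_)
  have h1 := (ac_expWeight δ).ae_le (expWeightIncl_ae h f)
  rw [hf] at h1
  filter_upwards [h1, (ac_expWeight δ).ae_le (Lp.coeFn_zero ℝ 2 (expWeight δ))] with x hx hx'
  rw [← hx, hx']

/-- The inclusion forgets only the top component, and that is the weak derivative of the one before,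
hence zero as soon as the others are. -/
theorem sobolevIncl_injective (k : ℕ) {δ δ' : ℝ} (hδ : 0 ≤ δ') (h : δ ≤ δ') :
    Function.Injective (sobolevIncl k h) := by
  rw [injective_iff_map_eq_zero]
  intro u hu
  have h0 : ∀ i : Fin (k + 1), u.1 i.castSucc = 0 := fun i =>
    expWeightIncl_injective h (by
      rw [map_zero]
      exact congrArg (fun v : WeightedSobolev k δ => v.1 i) hu)
  refine Subtype.ext (PiLp.ext fun j => ?_)
  induction j using Fin.lastCases with
  | cast i => exact h0 i
  | last =>
    refine eq_zero_of_inner_eq_zero hδ _ fun φ => ?_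
    have := inner_derivT hδ u (Fin.last k) φ
    rw [h0, map_zero, inner_zero_right, Fin.succ_last] at this
    linarith

theorem dense_range_toL2 (δ : ℝ) : DenseRange (toL2 δ) := by
  intro f
  refine (mem_closure_iff_nhds_basis Metric.nhds_basis_closedBall).2 fun ε hε ↦ ?_
  obtain ⟨g, hg₁, hg₂, hg₃⟩ := MemLp.exist_eLpNorm_sub_le (p := 2) (by norm_num) (by norm_num)
    (Lp.memLp f) hε
  refine ⟨toL2 δ ⟨g, hg₂, hg₁⟩, ⟨_, rfl⟩, ?_⟩
  have : (f : ℝ → ℝ) - (toL2 δ ⟨g, hg₂, hg₁⟩ : ℝ → ℝ) =ᵐ[expWeight δ] (f : ℝ → ℝ) - g := by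
    filter_upwards [toL2_ae δ ⟨g, hg₂, hg₁⟩] with x hx
    simp [hx]
  rw [Metric.mem_closedBall', Lp.dist_def, eLpNorm_congr_ae this]
  exact ENNReal.toReal_le_of_le_ofReal hε.le hg₃

/-- The zeroth weighted Sobolev space is the weighted `L²` space. -/
theorem exists_sobolev_zero_equiv (δ : ℝ) {μ : Measure ℝ} (hμ : expWeight δ = μ) :
    ∃ J : WeightedSobolev 0 δ ≃ₗᵢ[ℝ] Lp ℝ 2 μ, ∀ u, J u =ᵐ[μ] u.1 0 := by
  subst hμ
  let J₀ : WeightedSobolev 0 δ →ₗᵢ[ℝ] Lp ℝ 2 (expWeight δ) :=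
    { toFun := fun u => u.1 0
      map_add' := fun _ _ => rfl
      map_smul' := fun _ _ => rfl
      norm_map' := fun u => by
        rw [norm_sobolev, Fin.sum_univ_one]
        rfl }
  have hs : Function.Surjective J₀ := by
    rw [← Set.range_eq_univ, ← J₀.isometry.isClosedEmbedding.isClosed_range.closure_eq,
      ← dense_iff_closure_eq]
    refine (dense_range_toL2 δ).mono ?_
    rintro _ ⟨φ, rfl⟩
    exact ⟨toSob 0 δ φ, rfl⟩
  exact ⟨LinearIsometryEquiv.ofSurjective J₀ hs, fun _ => EventuallyEq.rfl⟩

/-- The pairing sees only the part of `f` on [r - a, r + a], where the weight exp(δ|x|) is at least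
exp(δ(r - a)); dividing by it produces the decay. The vanishing weight is a variable `d` so that `δ
0` can be put in its place. -/
theorem exists_inner_trans_le {d δ : ℝ} (hd : d = 0) (hδ : d ≤ δ) (φ : TestFn) :
    ∃ C, ∀ r (f : Lp ℝ 2 (expWeight δ)), |inner ℝ (toL2 d (trans r φ)) (expWeightIncl hδ f)| ≤
      C * Real.exp (-δ * r) * ‖f‖ := by
  subst hd
  obtain ⟨a, ha, hs⟩ := φ.exists_support
  obtain ⟨M, hM0, hM⟩ := φ.exists_bound
  have hn : ∀ r, ‖toL2 0 (trans r φ)‖ ≤ Real.sqrt (2 * a) * M := by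
    intro r
    refine (norm_toL2_le (d := 0) (a := r - a) (b := r + a) (trans r φ) hM0
      (fun x => hM _) (fun x hx => hs _ ?_) fun x hx => by simp).trans (le_of_eq ?_)
    · contrapose! hx
      rw [abs_le] at hx
      constructor <;> linarith
    · rw [Real.exp_zero, mul_one]
      ring_nf
  refine ⟨Real.sqrt (2 * a) * M * Real.exp (δ * a), fun r f => ?_⟩
  set K := Set.Icc (r - a) (r + a)
  set F := expWeightIncl hδ f
  have hF' : MemLp (K.indicator F) 2 (expWeight 0) := (Lp.memLp F).indicator measurableSet_Icc
  have h1 : inner ℝ (toL2 0 (trans r φ)) F = inner ℝ (toL2 0 (trans r φ)) (hF'.toLp _) := by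
    rw [inner_toL2, inner_toL2]
    refine integral_congr_ae ?_
    filter_upwards [hF'.coeFn_toLp] with x hx
    rw [hx]
    by_cases hxK : x ∈ K
    · rw [Set.indicator_of_mem hxK]
    · have : (trans r φ).1 x = 0 := hs _ (by
        contrapose! hxK
        rw [abs_le] at hxK
        constructor <;> linarith)
      rw [this, zero_mul, zero_mul]
  have h2 : ‖hF'.toLp _‖ ≤ Real.exp (δ * a) * Real.exp (-δ * r) * ‖f‖ := by
    rw [Lp.norm_toLp, eLpNorm_indicator_eq_eLpNorm_restrict measurableSet_Icc]
    have h3 : eLpNorm F 2 ((expWeight 0).restrict K) = eLpNorm f 2 (volume.restrict K) := by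
      rw [eLpNorm_expWeight_zero]
      exact eLpNorm_congr_ae (ae_restrict_of_ae ((ac_expWeight 0).ae_le (expWeightIncl_ae hδ f)))
    have h4 : ENNReal.ofReal (Real.exp (2 * (δ * (r - a)))) • volume.restrict K ≤ expWeight δ :=
      (le_expWeight_restrict measurableSet_Icc fun x hx => by
        have : r - a ≤ |x| := hx.1.trans (le_abs_self x)
        gcongr).trans Measure.restrict_le_self
    have h5 := eLpNorm_mono_measure (p := 2) f h4
    rw [eLpNorm_smul_measure_of_ne_top (by norm_num), smul_eq_mul,
      ENNReal.ofReal_rpow_of_pos (by positivity)] at h5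
    have h6 : Real.exp (2 * (δ * (r - a))) ^ (1 / (2 : ℝ≥0∞)).toReal = Real.exp (δ * (r - a)) := by
      rw [← Real.exp_mul]
      norm_num
      ring
    rw [h6] at h5
    have h7 := ENNReal.toReal_mono (Lp.eLpNorm_ne_top f) h5
    rw [ENNReal.toReal_mul, ENNReal.toReal_ofReal (by positivity), ← Lp.norm_def] at h7
    rw [h3, ← Real.exp_add, show δ * a + -δ * r = -(δ * (r - a)) by ring, Real.exp_neg,
      ← div_eq_inv_mul, le_div_iff₀ (by positivity), mul_comm]
    exact h7
  rw [h1]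
  refine (abs_real_inner_le_norm _ _).trans
    ((mul_le_mul (hn r) h2 (norm_nonneg _) (by positivity)).trans (le_of_eq ?_))
  ring

/-- Far translates are orthogonal to a given test function. -/
theorem exists_inner_trans_eq_zero (φ ψ : TestFn) :
    ∃ R, ∀ r, R < r → inner ℝ (toL2 0 (trans r φ)) (toL2 0 ψ) = 0 := by
  obtain ⟨a, ha, hs⟩ := φ.exists_support
  obtain ⟨b, hb, hs'⟩ := ψ.exists_support
  refine ⟨a + b, fun r hr => ?_⟩
  rw [inner_toL2_toL2]
  refine integral_eq_zero_of_ae (Eventually.of_forall fun x => ?_)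
  by_cases hx : b < |x|
  · simp [hs' x hx]
  · have : (trans r φ).1 x = 0 := hs _ (by
      rw [lt_abs]
      right
      have := abs_le.1 (not_lt.1 hx)
      linarith)
    simp [this]

theorem inner_trans_trans (r : ℝ) (φ ψ : TestFn) :
    inner ℝ (toL2 0 (trans r φ)) (toL2 0 (trans r ψ)) = inner ℝ (toL2 0 φ) (toL2 0 ψ) := by
  rw [inner_toL2_toL2, inner_toL2_toL2]
  exact integral_sub_right_eq_self (fun x => φ.1 x * ψ.1 x) r

/-- A normalized bump and a translate of it with disjoint support. -/
theorem exists_orthonormal : ∃ φ ψ : TestFn, inner ℝ (toL2 0 φ) (toL2 0 φ) = 1 ∧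
    inner ℝ (toL2 0 ψ) (toL2 0 ψ) = 1 ∧ inner ℝ (toL2 0 φ) (toL2 0 ψ) = 0 := by
  let b : ContDiffBump (0 : ℝ) := ⟨1, 2, one_pos, one_lt_two⟩
  let β : TestFn := ⟨b, b.contDiff, b.hasCompactSupport⟩
  have hβ : toL2 0 β ≠ 0 := by
    intro h
    have h1 := toL2_ae 0 β
    rw [h] at h1
    have h2 := (ac_expWeight 0).ae_le (h1.symm.trans (Lp.coeFn_zero ℝ 2 (expWeight 0)))
    have h3 := (Continuous.ae_eq_iff_eq volume β.continuous continuous_zero).1 h2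
    have h4 : b 0 = 0 := congrFun h3 0
    rw [b.one_of_mem_closedBall (Metric.mem_closedBall_self b.rIn_pos.le)] at h4
    exact one_ne_zero h4
  obtain ⟨R, hR⟩ := exists_inner_trans_eq_zero β β
  have hn : ‖toL2 0 β‖ ≠ 0 := norm_ne_zero_iff.2 hβ
  refine ⟨‖toL2 0 β‖⁻¹ • β, trans (R + 1) (‖toL2 0 β‖⁻¹ • β), ?_, ?_, ?_⟩
  · rw [map_smul, real_inner_smul_left, real_inner_smul_right, real_inner_self_eq_norm_sq]
    field_simp
  · rw [inner_trans_trans, map_smul, real_inner_smul_left, real_inner_smul_right,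
      real_inner_self_eq_norm_sq]
    field_simp
  · rw [map_smul, map_smul, map_smul, real_inner_smul_left, real_inner_smul_right,
      real_inner_comm, hR _ (lt_add_one R)]
    simp

end TestFn

/-! ### Compactness of the inclusions -/

theorem expWeight_restrict_le_smul {δ δ' d : ℝ} {K : Set ℝ} (hK : MeasurableSet K)
    (h : ∀ x ∈ K, δ * |x| ≤ d + δ' * |x|) :
    (expWeight δ).restrict K ≤ ENNReal.ofReal (Real.exp (2 * d)) • expWeight δ' := by
  rw [expWeight, expWeight, restrict_withDensity hK, ← withDensity_smul _ (by fun_prop)]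
  refine le_trans ?_ (Measure.restrict_le_self (s := K))
  rw [restrict_withDensity hK]
  refine withDensity_mono ((ae_restrict_iff' hK).2 (Eventually.of_forall fun x hx => ?_))
  rw [Pi.smul_apply, smul_eq_mul, ← ENNReal.ofReal_mul (by positivity), ← Real.exp_add]
  refine ENNReal.ofReal_le_ofReal (Real.exp_le_exp.2 ?_)
  linarith [h x hx]

theorem coeFn_finset_sum_Lp {ι : Type*} (μ : Measure ℝ) (s : Finset ι) (f : ι → Lp ℝ 2 μ) :
    ⇑(∑ j ∈ s, f j) =ᵐ[μ] fun x => ∑ j ∈ s, f j x := by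
  classical
  induction s using Finset.induction_on with
  | empty =>
    simp only [Finset.sum_empty]
    exact Lp.coeFn_zero ℝ 2 μ
  | insert a s ha ih =>
    simp only [Finset.sum_insert ha]
    filter_upwards [Lp.coeFn_add (f a) (∑ j ∈ s, f j), ih] with x hx hx'
    rw [hx, Pi.add_apply, hx']

theorem isCompactOperator_of_forall_approx {V W : Type*} [NormedAddCommGroup V] [NormedSpace ℝ V]
    [NormedAddCommGroup W] [NormedSpace ℝ W] [CompleteSpace W] (f : V →L[ℝ] W)
    (h : ∀ ε > 0, ∃ g : V →L[ℝ] W, IsCompactOperator g ∧ ‖f - g‖ < ε) : IsCompactOperator f := by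
  have hcl := isClosed_setOfPred_isCompactOperator (σ₁₂ := RingHom.id ℝ) (M₁ := V) (M₂ := W)
  have hf : f ∈ closure {f : V →L[ℝ] W | IsCompactOperator f} :=
    Metric.mem_closure_iff.2 fun ε hε => by
      obtain ⟨g, hg, hfg⟩ := h ε hε
      exact ⟨g, hg, by rwa [dist_eq_norm]⟩
  rwa [hcl.closure_eq] at hf

namespace TestFn

/-- Cauchy–Schwarz for the integral of ψ' over the interval between the two points. -/
theorem abs_sub_le (ψ : TestFn) {s x y : ℝ} (h : |x - y| ≤ s) :
    |ψ.1 x - ψ.1 y| ≤ Real.sqrt s * ‖toL2 0 (derivT ψ)‖ := by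
  wlog hxy : y ≤ x generalizing x y
  · rw [abs_sub_comm] at h ⊢
    exact this h (le_of_not_ge hxy)
  have h1 : ψ.1 x - ψ.1 y = ∫ z in y..x, (derivT ψ).1 z :=
    (intervalIntegral.integral_eq_sub_of_hasDerivAt (fun z _ => ψ.hasDerivAt z)
      ((derivT ψ).continuous.intervalIntegrable _ _)).symm
  have hfin : expWeight 0 (Set.Ioc y x) ≠ ⊤ := by
    rw [expWeight_zero]
    simp
  have h2 := L2.inner_indicatorConstLp_one (𝕜 := ℝ) (μ := expWeight 0) measurableSet_Ioc hfin
    (toL2 0 (derivT ψ))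
  have h3 : ∫ z in Set.Ioc y x, toL2 0 (derivT ψ) z ∂(expWeight 0) =
      ∫ z in Set.Ioc y x, (derivT ψ).1 z := by
    rw [← integral_congr_ae (ae_restrict_of_ae (toL2_ae 0 (derivT ψ)).symm), expWeight_zero]
  have h4 : ‖indicatorConstLp 2 measurableSet_Ioc hfin (1 : ℝ)‖ ≤ Real.sqrt s := by
    refine norm_indicatorConstLp_le.trans ?_
    rw [expWeight_zero, Real.volume_real_Ioc_of_le hxy, norm_one, one_mul,
      show 1 / (2 : ℝ≥0∞).toReal = 1 / 2 by simp, ← Real.sqrt_eq_rpow]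
    exact Real.sqrt_le_sqrt ((le_abs_self _).trans h)
  rw [h1, intervalIntegral.integral_of_le hxy, ← h3, ← h2]
  exact (abs_real_inner_le_norm _ _).trans (by gcongr)

theorem cell_ne_top (δ s : ℝ) (j : ℤ) : expWeight δ (Set.Ico (j * s) ((j + 1) * s)) ≠ ⊤ :=
  (isCompact_Icc.measure_lt_top.trans_le' (measure_mono Set.Ico_subset_Icc_self)).ne

/-- The indicator function of the interval `[js, (j+1)s)`. -/
noncomputable def cell (δ s : ℝ) (j : ℤ) : Lp ℝ 2 (expWeight δ) :=
  indicatorConstLp 2 measurableSet_Ico (cell_ne_top δ s j) 1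

/-- Replace a function on `[-Ns, Ns)` by its averages over the intervals `[js, (j+1)s)`. -/
noncomputable def averageOp (δ s : ℝ) (N : ℕ) {δ' : ℝ} (h : 0 ≤ δ') :
    Lp ℝ 2 (expWeight δ') →L[ℝ] Lp ℝ 2 (expWeight δ) :=
  ∑ j ∈ Finset.Ico (-N : ℤ) N,
    (s⁻¹ • (innerSL ℝ (cell 0 s j)).comp (expWeightIncl h)).smulRight (cell δ s j)

theorem isCompactOperator_averageOp (δ s : ℝ) (N : ℕ) {δ' : ℝ} (h : 0 ≤ δ') :
    IsCompactOperator (averageOp δ s N h) := by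
  have : ∀ S : Finset ℤ, IsCompactOperator ((∑ j ∈ S,
      (s⁻¹ • (innerSL ℝ (cell 0 s j)).comp (expWeightIncl h)).smulRight (cell δ s j) :
        Lp ℝ 2 (expWeight δ') →L[ℝ] Lp ℝ 2 (expWeight δ))) := by
    intro S
    induction S using Finset.induction_on with
    | empty =>
      simp only [Finset.sum_empty]
      exact isCompactOperator_zero
    | insert a S ha ih =>
      rw [Finset.sum_insert ha]
      refine IsCompactOperator.add ?_ ih
      have h1 := isCompactOperator_of_locallyCompactSpace_dom
        (s⁻¹ • (innerSL ℝ (cell 0 s a)).comp (expWeightIncl h))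
      exact h1.clm_comp (ContinuousLinearMap.toSpanSingleton ℝ (cell δ s a))
  simpa only [averageOp] using this _

theorem averageOp_toL2_ae (δ s : ℝ) (N : ℕ) {δ' : ℝ} (h : 0 ≤ δ') (ψ : TestFn) :
    averageOp δ s N h (toL2 δ' ψ) =ᵐ[expWeight δ] fun x => ∑ j ∈ Finset.Ico (-N : ℤ) N,
      (s⁻¹ * ∫ y in Set.Ico (j * s) ((j + 1) * s), ψ.1 y) *
        (Set.Ico (j * s) ((j + 1) * s)).indicator (fun _ => (1 : ℝ)) x := by
  have h1 : ∀ j : ℤ, inner ℝ (cell 0 s j) (expWeightIncl h (toL2 δ' ψ)) =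
      ∫ y in Set.Ico (j * s) ((j + 1) * s), ψ.1 y := by
    intro j
    rw [cell, L2.inner_indicatorConstLp_one (𝕜 := ℝ), expWeightIncl_toL2,
      ← integral_congr_ae (ae_restrict_of_ae (toL2_ae 0 ψ).symm), expWeight_zero]
  have h2 : averageOp δ s N h (toL2 δ' ψ) = ∑ j ∈ Finset.Ico (-N : ℤ) N,
      (s⁻¹ * ∫ y in Set.Ico (j * s) ((j + 1) * s), ψ.1 y) • cell δ s j := by
    rw [averageOp, _root_.sum_apply]
    refine Finset.sum_congr rfl fun j _ => ?_
    rw [← h1]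
    rfl
  rw [h2]
  refine (coeFn_finset_sum_Lp _ _ _).trans ?_
  have h3 : ∀ j : ℤ, ∀ᵐ x ∂(expWeight δ),
      ((s⁻¹ * ∫ y in Set.Ico (j * s) ((j + 1) * s), ψ.1 y) • cell δ s j) x =
      (s⁻¹ * ∫ y in Set.Ico (j * s) ((j + 1) * s), ψ.1 y) *
        (Set.Ico (j * s) ((j + 1) * s)).indicator (fun _ => (1 : ℝ)) x := by
    intro j
    filter_upwards [Lp.coeFn_smul (s⁻¹ * ∫ y in Set.Ico (j * s) ((j + 1) * s), ψ.1 y)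
      (cell δ s j), indicatorConstLp_coeFn (hs := measurableSet_Ico)
      (hμs := cell_ne_top δ s j) (c := (1 : ℝ))] with x hx hx'
    rw [hx, Pi.smul_apply, smul_eq_mul]
    exact congrArg _ hx'
  filter_upwards [ae_all_iff.2 h3] with x hx
  exact Finset.sum_congr rfl fun j _ => hx j

theorem abs_sub_average_le {s : ℝ} (hs : 0 < s) (N : ℕ) (ψ : TestFn) {x : ℝ}
    (hx : x ∈ Set.Ico (-(N * s)) (N * s)) :
    |ψ.1 x - ∑ j ∈ Finset.Ico (-N : ℤ) N,
      (s⁻¹ * ∫ y in Set.Ico (j * s) ((j + 1) * s), ψ.1 y) *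
        (Set.Ico (j * s) ((j + 1) * s)).indicator (fun _ => (1 : ℝ)) x| ≤
      Real.sqrt s * ‖toL2 0 (derivT ψ)‖ := by
  -- The point x lies in exactly one cell, so the sum reduces to the average over that cell.
  have hmem : ∀ j : ℤ, x ∈ Set.Ico (j * s) ((j + 1) * s) ↔ ⌊x / s⌋ = j := by
    intro j
    rw [Int.floor_eq_iff, le_div_iff₀ hs, div_lt_iff₀ hs, Set.mem_Ico]
  set j := ⌊x / s⌋ with hj
  have hxj : x ∈ Set.Ico (j * s) ((j + 1) * s) := (hmem j).2 rfl
  rw [Finset.sum_eq_single_of_mem j]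
  · rw [Set.indicator_of_mem hxj, mul_one]
    have hv : volume.real (Set.Ico (j * s) ((j + 1) * s)) = s := by
      rw [Real.volume_real_Ico_of_le (by nlinarith)]
      ring
    have hi : IntegrableOn ψ.1 (Set.Ico (j * s) ((j + 1) * s)) :=
      (ψ.continuous.integrableOn_Icc).mono_set Set.Ico_subset_Icc_self
    have h1 : ψ.1 x - s⁻¹ * ∫ y in Set.Ico (j * s) ((j + 1) * s), ψ.1 y =
        s⁻¹ * ∫ y in Set.Ico (j * s) ((j + 1) * s), (ψ.1 x - ψ.1 y) := by
      have hc : IntegrableOn (fun _ => ψ.1 x) (Set.Ico (j * s) ((j + 1) * s)) volume :=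
        integrableOn_const (by simp) (by simp)
      rw [integral_sub hc.integrable hi.integrable, setIntegral_const, hv, smul_eq_mul]
      field_simp
    rw [h1, abs_mul, abs_of_pos (inv_pos.2 hs), inv_mul_le_iff₀ hs]
    have := norm_setIntegral_le_of_norm_le_const (μ := volume)
      (s := Set.Ico (j * s) ((j + 1) * s)) (f := fun y => ψ.1 x - ψ.1 y)
      (C := Real.sqrt s * ‖toL2 0 (derivT ψ)‖) (by simp) (fun y hy => abs_sub_le ψ (by
        rw [abs_le]
        constructor <;> linarith [hxj.1, hxj.2, hy.1, hy.2]))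
    rw [hv] at this
    rw [mul_comm s]
    exact this
  · rw [Finset.mem_Ico, hj]
    constructor
    · rw [Int.le_floor, le_div_iff₀ hs]
      push_cast
      linarith [hx.1]
    · rw [Int.floor_lt, div_lt_iff₀ hs]
      exact_mod_cast hx.2
  · intro i _ hij
    rw [Set.indicator_of_notMem, mul_zero]
    rw [hmem]
    exact fun h => hij h.symm

/-- On [-Ns, Ns) the Hölder bound of `abs_sub_average_le` is integrated against the largest weight.
Outside, the averages vanish and the quotient of the two weights is at most exp(-(δ' - δ)Ns). -/
theorem norm_toL2_sub_averageOp_le {δ δ' s : ℝ} (hδ : 0 ≤ δ) (h : 0 ≤ δ') (hδδ' : δ ≤ δ')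
    (hs : 0 < s) (N : ℕ) (ψ : TestFn) :
    ‖toL2 δ ψ - averageOp δ s N h (toL2 δ' ψ)‖ ≤
      Real.sqrt (2 * (N * s)) * Real.exp (δ * (N * s)) * (Real.sqrt s * ‖toL2 0 (derivT ψ)‖) +
      Real.exp (-((δ' - δ) * (N * s))) * ‖toL2 δ' ψ‖ := by
  set R := N * s
  have hR : 0 ≤ R := by positivity
  set S := Set.Ico (-R) R
  set F := toL2 δ ψ - averageOp δ s N h (toL2 δ' ψ)
  set G := fun x => ψ.1 x - ∑ j ∈ Finset.Ico (-N : ℤ) N,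
      (s⁻¹ * ∫ y in Set.Ico (j * s) ((j + 1) * s), ψ.1 y) *
        (Set.Ico (j * s) ((j + 1) * s)).indicator (fun _ => (1 : ℝ)) x
  have hFG : F =ᵐ[expWeight δ] G := by
    filter_upwards [Lp.coeFn_sub (toL2 δ ψ) (averageOp δ s N h (toL2 δ' ψ)), toL2_ae δ ψ,
      averageOp_toL2_ae δ s N h ψ] with x h1 h2 h3
    rw [h1, Pi.sub_apply, h2, h3]
  have hG : MemLp G 2 (expWeight δ) := (memLp_congr_ae hFG).1 (Lp.memLp F)
  have hout : ∀ x ∈ Sᶜ, G x = ψ.1 x := by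
    intro x hx
    refine sub_eq_self.2 (Finset.sum_eq_zero fun j hj => ?_)
    rw [Set.indicator_of_notMem, mul_zero]
    contrapose! hx
    rw [Set.notMem_compl_iff]
    rw [Finset.mem_Ico] at hj
    have h1 : (-N : ℝ) ≤ j := by exact_mod_cast hj.1
    have h2 : (j + 1 : ℝ) ≤ N := by exact_mod_cast hj.2
    constructor
    · calc -R = (-N : ℝ) * s := by ring
        _ ≤ j * s := by gcongr
        _ ≤ x := hx.1
    · calc x < (j + 1) * s := hx.2
        _ ≤ N * s := by gcongr
  have hin : eLpNorm G 2 ((expWeight δ).restrict S) ≤ ENNReal.ofReal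
      (Real.sqrt (2 * R) * Real.exp (δ * R) * (Real.sqrt s * ‖toL2 0 (derivT ψ)‖)) := by
    refine (eLpNorm_le_of_ae_bound (C := Real.sqrt s * ‖toL2 0 (derivT ψ)‖)
      ((ae_restrict_iff' measurableSet_Ico).2 (Eventually.of_forall fun x hx =>
        abs_sub_average_le hs N ψ hx))).trans ?_
    rw [ENNReal.ofReal_mul (by positivity : 0 ≤ Real.sqrt (2 * R) * Real.exp (δ * R))]
    refine mul_le_mul_left ?_ _
    have h4 : (expWeight δ).restrict S Set.univ ≤
        ENNReal.ofReal (Real.exp (2 * (δ * R)) * (2 * R)) := by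
      refine (expWeight_restrict_le (d := δ * R) measurableSet_Ico (fun x hx => ?_)
        Set.univ).trans ?_
      · have := abs_le.2 ⟨hx.1, hx.2.le⟩
        gcongr
      · rw [ENNReal.ofReal_mul (by positivity)]
        simp [two_mul]
    refine (ENNReal.rpow_le_rpow h4 (by simp)).trans ?_
    rw [ENNReal.ofReal_rpow_of_nonneg (by positivity) (by simp)]
    refine ENNReal.ofReal_le_ofReal (le_of_eq ?_)
    rw [show ((2 : ℝ≥0∞).toReal)⁻¹ = (1 / 2 : ℝ) by norm_num, ← Real.sqrt_eq_rpow,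
      Real.sqrt_mul (by positivity), mul_comm, two_mul (δ * R), Real.exp_add,
      Real.sqrt_mul_self (by positivity)]
  have hex : eLpNorm G 2 ((expWeight δ).restrict Sᶜ) ≤ ENNReal.ofReal
      (Real.exp (-((δ' - δ) * R)) * ‖toL2 δ' ψ‖) := by
    have h1 : eLpNorm G 2 ((expWeight δ).restrict Sᶜ) =
        eLpNorm ψ.1 2 ((expWeight δ).restrict Sᶜ) :=
      eLpNorm_congr_ae ((ae_restrict_iff' measurableSet_Ico.compl).2
        (Eventually.of_forall hout))
    have h2 : (expWeight δ).restrict Sᶜ ≤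
        ENNReal.ofReal (Real.exp (2 * (-((δ' - δ) * R)))) • expWeight δ' := by
      refine expWeight_restrict_le_smul measurableSet_Ico.compl fun x hx => ?_
      have : R ≤ |x| := by
        by_contra! hlt
        exact hx ⟨(abs_lt.1 hlt).1.le, (abs_lt.1 hlt).2⟩
      nlinarith
    rw [h1]
    refine (eLpNorm_mono_measure _ h2).trans ?_
    rw [eLpNorm_smul_measure_of_ne_top (by norm_num), smul_eq_mul,
      ENNReal.ofReal_rpow_of_pos (by positivity), ENNReal.ofReal_mul (by positivity)]
    refine mul_le_mul' (ENNReal.ofReal_le_ofReal (le_of_eq ?_)) (le_of_eq ?_)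
    · rw [← Real.exp_mul]
      norm_num
      ring
    · have : ‖toL2 δ' ψ‖ = (eLpNorm ψ.1 2 (expWeight δ')).toReal :=
        Lp.norm_toLp _ (ψ.memLp δ')
      rw [this, ENNReal.ofReal_toReal (ψ.memLp δ').2.ne]
  rw [Lp.norm_def, eLpNorm_congr_ae hFG]
  refine ENNReal.toReal_le_of_le_ofReal (by positivity) ?_
  rw [ENNReal.ofReal_add (by positivity) (by positivity)]
  have hsum := eLpNorm_add_le (p := 2) (hG.indicator (s := S) measurableSet_Ico).1
    (hG.indicator (s := Sᶜ) measurableSet_Ico.compl).1 (by norm_num)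
  rw [Set.indicator_self_add_compl, eLpNorm_indicator_eq_eLpNorm_restrict measurableSet_Ico,
    eLpNorm_indicator_eq_eLpNorm_restrict measurableSet_Ico.compl] at hsum
  exact hsum.trans (add_le_add hin hex)

/-- The `i`-th component of a tuple in the weighted Sobolev space. -/
noncomputable def component (k : ℕ) (δ : ℝ) (i : Fin (k + 1)) :
    WeightedSobolev k δ →L[ℝ] Lp ℝ 2 (expWeight δ) :=
  (PiLp.proj 1 (𝕜 := ℝ) (fun _ => Lp ℝ 2 (expWeight δ)) i).comp
    (testTuples k δ).topologicalClosure.subtypeL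

/-- The `i`-th component of the inclusion of weighted Sobolev spaces. -/
noncomputable def componentIncl (k : ℕ) {δ δ' : ℝ} (h : δ ≤ δ') (i : Fin (k + 1)) :
    WeightedSobolev (k + 1) δ' →L[ℝ] Lp ℝ 2 (expWeight δ) :=
  (expWeightIncl h).comp (component (k + 1) δ' i.castSucc)

theorem norm_component_le {k : ℕ} {δ : ℝ} (u : WeightedSobolev k δ) (i : Fin (k + 1)) :
    ‖u.1 i‖ ≤ ‖u‖ := by
  rw [norm_sobolev]
  exact Finset.single_le_sum (f := fun i => ‖u.1 i‖) (fun _ _ => norm_nonneg _)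
    (Finset.mem_univ i)

theorem norm_expWeightIncl_le {δ δ' : ℝ} (h : δ ≤ δ') (f : Lp ℝ 2 (expWeight δ')) :
    ‖expWeightIncl h f‖ ≤ ‖f‖ := by
  have h1 : ‖expWeightIncl h‖ ≤ 1 := LinearMap.mkContinuous_norm_le _ zero_le_one _
  exact ((expWeightIncl h).le_of_opNorm_le h1 f).trans_eq (one_mul _)

theorem norm_componentIncl_sub_le (k : ℕ) {δ δ' s : ℝ} (hδ : 0 ≤ δ) (h : δ ≤ δ') (hs : 0 < s)
    (N : ℕ) (i : Fin (k + 1)) :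
    ‖componentIncl k h i - (averageOp δ s N (hδ.trans h)).comp
      (component (k + 1) δ' i.castSucc)‖ ≤
      Real.sqrt (2 * (N * s)) * Real.exp (δ * (N * s)) * Real.sqrt s +
        Real.exp (-((δ' - δ) * (N * s))) := by
  refine ContinuousLinearMap.opNorm_le_bound _ (by positivity) fun u => ?_
  refine DenseRange.induction_on (denseRange_toSob (k + 1) δ') u
    (isClosed_le (ContinuousLinearMap.continuous _).norm
      (continuous_const.mul continuous_norm)) fun φ => ?_
  set ψ := (derivT ^ (i : ℕ)) φ
  have h1 := norm_toL2_sub_averageOp_le hδ (hδ.trans h) h hs N ψ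
  have h2 : ‖toL2 δ' ψ‖ ≤ ‖toSob (k + 1) δ' φ‖ := norm_component_le (toSob (k + 1) δ' φ) i.castSucc
  have h3 : ‖toL2 0 (derivT ψ)‖ ≤ ‖toSob (k + 1) δ' φ‖ := by
    rw [← expWeightIncl_toL2 (hδ.trans h)]
    refine (norm_expWeightIncl_le _ _).trans ?_
    have h4 := norm_component_le (toSob (k + 1) δ' φ) i.succ
    rwa [toSob_apply, Fin.val_succ, pow_succ', Module.End.mul_apply] at h4
  have h5 : (componentIncl k h i - (averageOp δ s N (hδ.trans h)).comp
      (component (k + 1) δ' i.castSucc)) (toSob (k + 1) δ' φ) =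
      toL2 δ ψ - averageOp δ s N (hδ.trans h) (toL2 δ' ψ) := by
    rw [← expWeightIncl_toL2 h]
    rfl
  rw [h5, add_mul, mul_assoc _ (Real.sqrt s)]
  exact h1.trans (by gcongr)

/-- Norm limit of finite rank operators: the strict gap δ < δ' makes the tail small for a long
interval; with that interval fixed, a fine mesh makes the inner error small. -/
theorem isCompactOperator_componentIncl (k : ℕ) {δ δ' : ℝ} (hδ : 0 ≤ δ) (h : δ < δ')
    (i : Fin (k + 1)) : IsCompactOperator (componentIncl k h.le i) := by
  refine isCompactOperator_of_forall_approx _ fun ε hε => ?_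
  have ht : Tendsto (fun n : ℕ => Real.exp (-((δ' - δ) * (n : ℝ)))) atTop (𝓝 0) := by
    refine Real.tendsto_exp_neg_atTop_nhds_zero.comp ?_
    exact tendsto_natCast_atTop_atTop.const_mul_atTop (sub_pos.2 h)
  obtain ⟨n, hn⟩ := (ht.eventually_lt_const (half_pos hε)).exists
  have ht' : Tendsto (fun m : ℕ => Real.sqrt (2 * (n : ℝ)) * Real.exp (δ * n) *
      Real.sqrt (1 / ((m : ℝ) + 1))) atTop (𝓝 0) := by
    have := (Real.continuous_sqrt.tendsto 0).comp tendsto_one_div_add_atTop_nhds_zero_nat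
    rw [Real.sqrt_zero] at this
    simpa using this.const_mul (Real.sqrt (2 * (n : ℝ)) * Real.exp (δ * n))
  obtain ⟨m, hm⟩ := (ht'.eventually_lt_const (half_pos hε)).exists
  -- Mesh 1/(m+1) with N = n(m+1) cells on each side keeps the half-length equal to n while the mesh
  -- is refined.
  have key := norm_componentIncl_sub_le k hδ h.le (s := 1 / ((m : ℝ) + 1)) (by positivity)
    (n * (m + 1)) i
  rw [show ((n * (m + 1) : ℕ) : ℝ) * (1 / ((m : ℝ) + 1)) = n by
    push_cast
    field_simp] at key
  have hT := (isCompactOperator_averageOp δ (1 / ((m : ℝ) + 1)) (n * (m + 1))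
    (hδ.trans h.le)).comp_clm (component (k + 1) δ' i.castSucc)
  exact ⟨_, hT, key.trans_lt (by linarith)⟩

theorem isCompactOperator_sobolevIncl (k : ℕ) {δ δ' : ℝ} (hδ : 0 ≤ δ) (h : δ < δ') :
    IsCompactOperator (sobolevIncl k h.le) := by
  choose K hK hK' using fun i => isCompactOperator_componentIncl k hδ h i
  have hc : IsCompactOperator ((tupleIncl k h.le).comp
      (testTuples (k + 1) δ').topologicalClosure.subtypeL) := by
    refine ⟨_, (isCompact_univ_pi hK).image (PiLp.continuous_toLp 1 _), ?_⟩
    filter_upwards [eventually_all.2 hK'] with u hu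
    exact ⟨fun i => componentIncl k h.le i u, fun i _ => hu i, rfl⟩
  exact hc.codRestrict (fun u => tupleIncl_mem k h.le u u.2)
    (testTuples k δ).isClosed_topologicalClosure

end TestFn

/-! ### Exponentially bounded functions and inversion -/

open Classical in
/-- The function `t ↦ g (1 / t)` on `t > 0`, extended by zero. -/
noncomputable def flatInv {V : Type*} [Zero V] (g : ℝ → V) (t : ℝ) : V := if 0 < t then g t⁻¹ else 0

theorem flatInv_of_pos {V : Type*} [Zero V] (g : ℝ → V) {t : ℝ} (ht : 0 < t) : flatInv g t = g t⁻¹ := if_pos ht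

theorem flatInv_of_nonpos {V : Type*} [Zero V] (g : ℝ → V) {t : ℝ} (ht : t ≤ 0) : flatInv g t = 0 :=
  if_neg (not_lt.2 ht)

section FlatInv

variable {V W U : Type*} [NormedAddCommGroup V] [NormedSpace ℝ V] [NormedAddCommGroup W]
  [NormedSpace ℝ W] [NormedAddCommGroup U] [NormedSpace ℝ U]

/-- Smooth functions all of whose derivatives are `O(exp (a r))` on `[0, ∞)`. -/
structure ExpBound (a : ℝ) (g : ℝ → V) : Prop where
  smooth : ContDiff ℝ ∞ g
  bound : ∀ n, ∃ C, ∀ r, 0 ≤ r → ‖iteratedDeriv n g r‖ ≤ C * Real.exp (a * r)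

theorem contDiff_infty_of_closed {ι : Type*} (F : ι → ℝ → V) (D : ι → ι) (c : ℝ)
    (h : ∀ i r, HasDerivAt (F i) (c • F (D i) r) r) (i : ι) : ContDiff ℝ ∞ (F i) := by
  rw [contDiff_infty]
  intro n
  induction n generalizing i with
  | zero =>
    rw [Nat.cast_zero, contDiff_zero]
    exact continuous_iff_continuousAt.2 fun r => (h i r).continuousAt
  | succ n ih =>
    rw [Nat.cast_succ, contDiff_succ_iff_deriv]
    refine ⟨fun r => (h i r).differentiableAt, by simp, ?_⟩
    rw [funext fun r => (h i r).deriv]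
    exact (ih (D i)).const_smul c

namespace ExpBound

/-- When differentiation maps the family into itself up to a constant, bounding its members bounds
all their derivatives. It is applied to polynomials, to polynomials times a Gaussian, and to
translates of all test functions. -/
theorem of_closed {ι : Type*} {a : ℝ} (F : ι → ℝ → V) (D : ι → ι) (c : ℝ)
    (h : ∀ i r, HasDerivAt (F i) (c • F (D i) r) r)
    (hb : ∀ i, ∃ C, ∀ r, 0 ≤ r → ‖F i r‖ ≤ C * Real.exp (a * r)) (i : ι) : ExpBound a (F i) := by
  have hs := contDiff_infty_of_closed F D c h
  refine ⟨hs i, fun n => ?_⟩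
  induction n generalizing i with
  | zero => simpa using hb i
  | succ n ih =>
    obtain ⟨C, hC⟩ := ih (D i)
    refine ⟨|c| * C, fun r hr => ?_⟩
    rw [iteratedDeriv_succ', show deriv (F i) = c • F (D i) from funext fun r => (h i r).deriv,
      iteratedDeriv_const_smul_field, norm_smul, Real.norm_eq_abs, mul_assoc]
    exact mul_le_mul_of_nonneg_left (hC r hr) (abs_nonneg c)

theorem deriv {a : ℝ} {g : ℝ → V} (h : ExpBound a g) : ExpBound a (deriv g) :=
  ⟨((contDiff_infty_iff_deriv (𝕜 := ℝ)).1 h.smooth).2, fun n => by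
    simpa only [← iteratedDeriv_succ'] using h.bound (n + 1)⟩

theorem norm_le {a : ℝ} {g : ℝ → V} (h : ExpBound a g) :
    ∃ C, 0 ≤ C ∧ ∀ r, 0 ≤ r → ‖g r‖ ≤ C * Real.exp (a * r) := by
  obtain ⟨C, hC⟩ := h.bound 0
  refine ⟨C, ?_, by simpa using hC⟩
  have := (norm_nonneg _).trans (hC 0 le_rfl)
  simpa using this

/-- Leibniz rule: exponential rates add. -/
theorem bilinear {a b : ℝ} {f : ℝ → V} {g : ℝ → W} (hf : ExpBound a f) (hg : ExpBound b g)
    (B : V →L[ℝ] W →L[ℝ] U) : ExpBound (a + b) fun r => B (f r) (g r) := by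
  refine ⟨(B.contDiff.comp hf.smooth).clm_apply hg.smooth, fun n => ?_⟩
  choose C hC using hf.bound
  choose C' hC' using hg.bound
  refine ⟨‖B‖ * ∑ i ∈ Finset.range (n + 1), (n.choose i : ℝ) * C i * C' (n - i),
    fun r hr => ?_⟩
  rw [← norm_iteratedFDeriv_eq_norm_iteratedDeriv]
  refine (B.norm_iteratedFDeriv_le_of_bilinear hf.smooth hg.smooth r
    (by exact_mod_cast le_top)).trans ?_
  rw [mul_assoc, Finset.sum_mul]
  refine mul_le_mul_of_nonneg_left (Finset.sum_le_sum fun i _ => ?_) (norm_nonneg B)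
  rw [norm_iteratedFDeriv_eq_norm_iteratedDeriv, norm_iteratedFDeriv_eq_norm_iteratedDeriv,
    add_mul, Real.exp_add]
  have h1 := mul_le_mul (hC i r hr) (hC' (n - i) r hr) (norm_nonneg _)
    ((norm_nonneg _).trans (hC i r hr))
  calc _ = (n.choose i : ℝ) * (‖iteratedDeriv i f r‖ * ‖iteratedDeriv (n - i) g r‖) := by ring
    _ ≤ (n.choose i : ℝ) * ((C i * Real.exp (a * r)) * (C' (n - i) * Real.exp (b * r))) := by
        gcongr
    _ = _ := by ring

end ExpBound

theorem exists_polynomial_bound (p : Polynomial ℝ) {ε : ℝ} (hε : 0 < ε) :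
    ∃ C, ∀ r, 0 ≤ r → ‖p.eval r‖ ≤ C * Real.exp (ε * r) := by
  induction p using Polynomial.induction_on' with
  | add p q hp hq =>
    obtain ⟨C, hC⟩ := hp
    obtain ⟨C', hC'⟩ := hq
    refine ⟨C + C', fun r hr => ?_⟩
    rw [Polynomial.eval_add, add_mul]
    exact (norm_add_le _ _).trans (add_le_add (hC r hr) (hC' r hr))
  | monomial n c =>
    refine ⟨|c| * (n.factorial / ε ^ n), fun r hr => ?_⟩
    have h1 := Real.pow_div_factorial_le_exp (ε * r) (by positivity) n
    rw [div_le_iff₀ (by positivity), mul_pow] at h1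
    rw [Polynomial.eval_monomial, norm_mul, Real.norm_eq_abs, Real.norm_eq_abs,
      abs_of_nonneg (pow_nonneg hr n), mul_assoc]
    gcongr
    rw [div_mul_eq_mul_div, le_div_iff₀ (by positivity)]
    linarith

theorem expBound_polynomial (p : Polynomial ℝ) {ε : ℝ} (hε : 0 < ε) :
    ExpBound ε fun r => p.eval r :=
  ExpBound.of_closed (fun (p : Polynomial ℝ) r => p.eval r) Polynomial.derivative 1
    (fun p r => by simpa using p.hasDerivAt r) (fun p => exists_polynomial_bound p hε) p

theorem expBound_gaussian (a : ℝ) : ExpBound a fun r => Real.exp (-r ^ 2) := by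
  have := ExpBound.of_closed (a := a)
    (fun (p : Polynomial ℝ) r => p.eval r * Real.exp (-r ^ 2))
    (fun p => Polynomial.derivative p - 2 * Polynomial.X * p) 1 (fun p r => ?_) (fun p => ?_) 1
  · simpa using this
  · have h1 := (p.hasDerivAt r).mul ((hasDerivAt_pow 2 r).neg.exp)
    refine h1.congr_deriv ?_
    simp only [one_smul, Pi.neg_apply, Polynomial.eval_sub, Polynomial.eval_mul, Polynomial.eval_X,
      Polynomial.eval_ofNat, Nat.cast_ofNat, pow_one, Nat.add_one_sub_one]
    ring
  · obtain ⟨C, hC⟩ := exists_polynomial_bound p one_pos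
    refine ⟨C * Real.exp ((a - 1) ^ 2 / 4), fun r hr => ?_⟩
    rw [norm_mul, Real.norm_of_nonneg (Real.exp_pos _).le, mul_assoc, ← Real.exp_add]
    refine (mul_le_mul_of_nonneg_right (hC r hr) (Real.exp_pos _).le).trans ?_
    rw [mul_assoc, ← Real.exp_add]
    have hC0 : 0 ≤ C := by simpa using (norm_nonneg _).trans (hC 0 le_rfl)
    refine mul_le_mul_of_nonneg_left (Real.exp_le_exp.2 ?_) hC0
    -- Completing the square: r - r² ≤ a r + (a - 1)²/4.
    nlinarith [sq_nonneg (r + (a - 1) / 2)]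

theorem contDiffOn_flatInv {g : ℝ → V} (hg : ContDiff ℝ ∞ g) :
    ContDiffOn ℝ ∞ (flatInv g) (Set.Ioi 0) := by
  have h1 : ContDiffOn ℝ ∞ (fun t : ℝ => g t⁻¹) (Set.Ioi 0) :=
    hg.comp_contDiffOn (contDiffOn_id.inv fun t ht => ne_of_gt ht)
  exact h1.congr fun t ht => flatInv_of_pos g ht

/-- Differentiating g(1/t) in t gives -r² g'(r) at r = 1/t. The factor r² is absorbed by giving up
half of the decay rate. -/
theorem ExpBound.sq_smul_deriv {a : ℝ} (ha : a < 0) {g : ℝ → V} (hg : ExpBound a g) :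
    ExpBound (a / 2) fun r => r ^ 2 • _root_.deriv g r := by
  have := (expBound_polynomial (Polynomial.X ^ 2) (ε := -(a / 2)) (by linarith)).bilinear hg.deriv
    (ContinuousLinearMap.lsmul ℝ ℝ)
  rw [show -(a / 2) + a = a / 2 by ring] at this
  simpa using this

theorem ExpBound.hasDerivAt_flatInv {a : ℝ} (ha : a < 0) {g : ℝ → V} (hg : ExpBound a g)
    (t : ℝ) : HasDerivAt (flatInv g)
      ((-1 : ℝ) • flatInv (fun r => r ^ 2 • _root_.deriv g r) t) t := by
  rcases lt_trichotomy t 0 with ht | rfl | ht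
  · rw [flatInv_of_nonpos _ ht.le, smul_zero]
    refine (hasDerivAt_const t (0 : V)).congr_of_eventuallyEq ?_
    filter_upwards [Iio_mem_nhds ht] with s hs using flatInv_of_nonpos g (le_of_lt hs)
  · rw [flatInv_of_nonpos _ le_rfl, smul_zero, hasDerivAt_iff_isLittleO_nhds_zero]
    simp only [zero_add, flatInv_of_nonpos g le_rfl, sub_zero, smul_zero]
    obtain ⟨C, hC0, hC⟩ := hg.norm_le
    have hO : flatInv g =O[𝓝 0] fun t : ℝ => t ^ 2 := by
      -- From x²/2 ≤ exp x at x = -a/t: exp(a/t) ≤ (2/a²) t², so the function is o(t) at 0.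
      refine IsBigO.of_bound (C * (2 / a ^ 2)) (Eventually.of_forall fun t => ?_)
      rcases le_or_gt t 0 with ht | ht
      · rw [flatInv_of_nonpos g ht, norm_zero]
        positivity
      · rw [flatInv_of_pos g ht, mul_assoc]
        refine (hC _ (inv_pos.2 ht).le).trans (mul_le_mul_of_nonneg_left ?_ hC0)
        have h1 := Real.pow_div_factorial_le_exp (-a * t⁻¹)
          (mul_nonneg (by linarith) (inv_pos.2 ht).le) 2
        rw [show a * t⁻¹ = -(-a * t⁻¹) by ring, Real.exp_neg, norm_pow, Real.norm_eq_abs,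
          sq_abs]
        refine inv_le_of_inv_le₀ (by have := ne_of_lt ha; positivity) (le_trans (le_of_eq ?_) h1)
        simp only [Nat.factorial]
        have := ne_of_lt ha
        field_simp
        norm_num
    exact hO.trans_isLittleO (isLittleO_pow_id one_lt_two)
  · have h1 := (hg.smooth.differentiable (by simp) t⁻¹).hasDerivAt.scomp t
      (hasDerivAt_inv ht.ne')
    rw [flatInv_of_pos _ ht]
    refine (h1.congr_of_eventuallyEq ?_).congr_deriv ?_
    · filter_upwards [Ioi_mem_nhds ht] with s hs using flatInv_of_pos g hs
    · rw [inv_pow, neg_smul, neg_smul, one_smul]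

/-- The rate is halved by each t-derivative but stays negative, so functions of negative rate form a
family closed under differentiation. -/
theorem ExpBound.contDiff_flatInv {a : ℝ} (ha : a < 0) {g : ℝ → V} (hg : ExpBound a g) :
    ContDiff ℝ ∞ (flatInv g) :=
  contDiff_infty_of_closed (ι := {g : ℝ → V // ∃ a < 0, ExpBound a g}) (fun g => flatInv g.1)
    (fun g => ⟨fun r => r ^ 2 • _root_.deriv g.1 r, by
      obtain ⟨a, ha, hg⟩ := g.2
      exact ⟨a / 2, by linarith, hg.sq_smul_deriv ha⟩⟩) (-1)
    (fun g t => by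
      obtain ⟨a, ha, hg⟩ := g.2
      exact hg.hasDerivAt_flatInv ha t) ⟨g, a, ha, hg⟩

/-- Joint continuity of a bounded family of operators which vanishes in the limit. -/
theorem continuous_flatInv_apply {g : ℝ → V →L[ℝ] V} (hg : ExpBound 0 g) {D : Set V}
    (hD : Dense D) (h : ∀ e ∈ D, ∃ R, ∀ r, R < r → g r e = 0) :
    Continuous fun p : ℝ × V => flatInv g p.1 p.2 := by
  obtain ⟨C, hC0, hC⟩ := hg.norm_le
  simp only [zero_mul, Real.exp_zero, mul_one] at hC
  rw [continuous_iff_continuousAt]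
  rintro ⟨t, e⟩
  rcases lt_trichotomy t 0 with ht | rfl | ht
  · refine (continuousAt_const (y := (0 : V))).congr ?_
    filter_upwards [(isOpen_Iio.prod isOpen_univ).mem_nhds
      (show (t, e) ∈ Set.Iio (0 : ℝ) ×ˢ Set.univ from ⟨ht, trivial⟩)] with p hp
    rw [flatInv_of_nonpos g (le_of_lt hp.1), _root_.zero_apply]
  · rw [ContinuousAt, flatInv_of_nonpos g le_rfl, _root_.zero_apply, Metric.tendsto_nhds_nhds]
    intro ε hε
    -- Replace the vector by a nearby φ in `D`, which is killed by g r for r > R, that is for t <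
    -- 1/(|R| + 1); the uniform bound `C` controls the difference.
    obtain ⟨φ, hφ, hφe⟩ := Metric.mem_closure_iff.1 (hD e) (ε / (2 * (C + 1))) (by positivity)
    obtain ⟨R, hR⟩ := h φ hφ
    refine ⟨min (ε / (2 * (C + 1))) (|R| + 1)⁻¹, by positivity, fun {p} hp => ?_⟩
    rw [dist_zero_right]
    rcases le_or_gt p.1 0 with hp0 | hp0
    · rw [flatInv_of_nonpos g hp0, _root_.zero_apply, norm_zero]
      exact hε
    have hp1 : p.1 < (|R| + 1)⁻¹ := by
      have h1 := (le_max_left _ _).trans_lt (hp.trans_le (min_le_right _ _))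
      rw [dist_zero_right, Real.norm_eq_abs] at h1
      exact (le_abs_self _).trans_lt h1
    have hp2 : dist p.2 e < ε / (2 * (C + 1)) :=
      (le_max_right _ _).trans_lt (hp.trans_le (min_le_left _ _))
    have hr : R < p.1⁻¹ := by
      have h2 := (lt_inv_comm₀ hp0 (by positivity)).1 hp1
      linarith [le_abs_self R]
    rw [flatInv_of_pos g hp0]
    have h3 : g p.1⁻¹ p.2 = g p.1⁻¹ (p.2 - φ) := by rw [map_sub, hR _ hr, sub_zero]
    rw [h3]
    have h4 : ‖p.2 - φ‖ < ε / (C + 1) := by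
      rw [← dist_eq_norm]
      calc dist p.2 φ ≤ dist p.2 e + dist e φ := dist_triangle _ _ _
        _ < ε / (2 * (C + 1)) + ε / (2 * (C + 1)) := add_lt_add hp2 hφe
        _ = ε / (C + 1) := by field_simp; norm_num
    calc ‖g p.1⁻¹ (p.2 - φ)‖ ≤ C * ‖p.2 - φ‖ :=
          (g p.1⁻¹).le_of_opNorm_le (hC _ (inv_pos.2 hp0).le) _
      _ ≤ (C + 1) * ‖p.2 - φ‖ := by gcongr; linarith
      _ < (C + 1) * (ε / (C + 1)) := by gcongr
      _ = ε := by field_simp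
  · have h1 : ContinuousAt (flatInv g) t :=
      (contDiffOn_flatInv hg.smooth).continuousOn.continuousAt (Ioi_mem_nhds ht)
    have h2 : ContinuousAt (fun p : ℝ × V => flatInv g p.1) (t, e) :=
      ContinuousAt.comp (g := flatInv g) (f := Prod.fst) h1 continuousAt_fst
    exact h2.clm_apply continuousAt_snd

end FlatInv

/-! ### Escaping families of rank one operators -/

theorem ExpBound.smulRight {V W : Type*} [NormedAddCommGroup V] [NormedSpace ℝ V]
    [NormedAddCommGroup W] [NormedSpace ℝ W] {a b : ℝ} {f : ℝ → V →L[ℝ] ℝ} {g : ℝ → W}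
    (hf : ExpBound a f) (hg : ExpBound b g) :
    ExpBound (a + b) fun r => (f r).smulRight (g r) :=
  hf.bilinear hg (ContinuousLinearMap.smulRightL ℝ V W)

/-- A family of vectors and functionals on a scale which are exponentially bounded with
opposite rates, such that the functionals vanish in the limit on dense subsets. -/
structure EscapingFamily (E : ScScale) (w : ℕ → ℝ) where
  vec : ∀ k, ℝ → E.lev k
  func : ∀ k, ℝ → E.lev k →L[ℝ] ℝ
  vec_ι : ∀ k r, E.ι k (vec (k + 1) r) = vec k r
  func_ι : ∀ k r e, func k r (E.ι k e) = func (k + 1) r e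
  vec_bound : ∀ k, ExpBound (w k) (vec k)
  func_bound : ∀ k, ExpBound (-w k) (func k)
  dense : ∀ k, Dense {e : E.lev k | ∃ R, ∀ r, R < r → func k r e = 0}

namespace EscapingFamily

variable {E : ScScale} {w : ℕ → ℝ} (b : EscapingFamily E w)

theorem inclZero_vec (k : ℕ) (r : ℝ) : E.inclZero k (b.vec k r) = b.vec 0 r := by
  induction k with
  | zero => rfl
  | succ k ih => rw [E.inclZero_succ, b.vec_ι, ih]

/-- The rank one operators on level `k`. -/
noncomputable def rankOne (k : ℕ) (r : ℝ) : E.lev k →L[ℝ] E.lev k :=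
  (b.func k r).smulRight (b.vec k r)

theorem rankOne_apply (k : ℕ) (r : ℝ) (e : E.lev k) :
    b.rankOne k r e = b.func k r e • b.vec k r := rfl

theorem expBound_rankOne (k : ℕ) : ExpBound 0 (b.rankOne k) := by
  have := (b.func_bound k).smulRight (b.vec_bound k)
  rwa [neg_add_cancel] at this

/-- The rank one operators from level `k + 1` to level `k`. -/
noncomputable def rankOneSucc (k : ℕ) (r : ℝ) : E.lev (k + 1) →L[ℝ] E.lev k :=
  (b.func (k + 1) r).smulRight (b.vec k r)

/-- The rates of functional and vector cancel on one level; across two levels they add up to w k - w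
(k + 1) < 0. This strict gap is what makes the family smooth at t = 0. -/
theorem contDiff_rankOneSucc (hw : StrictMono w) (k : ℕ) :
    ContDiff ℝ ∞ (flatInv (b.rankOneSucc k)) :=
  ((b.func_bound (k + 1)).smulRight (b.vec_bound k)).contDiff_flatInv
    (by linarith [hw (Nat.lt_succ_self k)])

theorem flatInv_rankOne_comp (k : ℕ) (t : ℝ) (e : E.lev (k + 1)) :
    flatInv (b.rankOne k) t (E.ι k e) = flatInv (b.rankOneSucc k) t e := by
  rcases le_or_gt t 0 with ht | ht
  · rw [flatInv_of_nonpos _ ht, flatInv_of_nonpos _ ht, _root_.zero_apply, _root_.zero_apply]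
  · rw [flatInv_of_pos _ ht, flatInv_of_pos _ ht, rankOne_apply, b.func_ι]
    rfl

theorem flatInv_rankOne_ι (k : ℕ) (t : ℝ) (e : E.lev (k + 1)) :
    flatInv (b.rankOne k) t (E.ι k e) = E.ι k (flatInv (b.rankOne (k + 1)) t e) := by
  rcases le_or_gt t 0 with ht | ht
  · rw [flatInv_of_nonpos _ ht, flatInv_of_nonpos _ ht, _root_.zero_apply, _root_.zero_apply,
      map_zero]
  · rw [flatInv_of_pos _ ht, flatInv_of_pos _ ht, rankOne_apply, rankOne_apply, b.func_ι,
      map_smul, b.vec_ι]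

/-- The family of rank one operators at `r = 1 / t`, extended by zero to `t ≤ 0`. -/
noncomputable def projFamily : ScMap ((ScScale.const ℝ).prod E) E where
  toFun k p := flatInv (b.rankOne k) p.1 p.2
  cont k := continuous_flatInv_apply (b.expBound_rankOne k) (b.dense k) (by
    rintro e ⟨R, hR⟩
    exact ⟨R, fun r hr => by rw [rankOne_apply, hR r hr, zero_smul]⟩)
  comm k p := b.flatInv_rankOne_ι k p.1 p.2

theorem contDiff_deriv_rankOneSucc (hw : StrictMono w) (k : ℕ) :
    ContDiff ℝ ∞ fun p : ℝ × E.lev (k + 1) => deriv (flatInv (b.rankOneSucc k)) p.1 p.2 := by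
  have := ((contDiff_infty_iff_deriv (𝕜 := ℝ)).1 (b.contDiff_rankOneSucc hw k)).2
  exact (this.comp contDiff_fst).clm_apply contDiff_snd

/-- The derivative of `projFamily` in the parameter. -/
noncomputable def projFamilyDeriv (hw : StrictMono w) :
    ScMap ((ScScale.const ℝ).prod E.shift) E where
  toFun k p := deriv (flatInv (b.rankOneSucc k)) p.1 p.2
  cont k := (b.contDiff_deriv_rankOneSucc hw k).continuous
  comm k p := by
    have hd : ∀ j, HasDerivAt (flatInv (b.rankOneSucc j))
        (deriv (flatInv (b.rankOneSucc j)) p.1) p.1 := fun j =>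
      ((b.contDiff_rankOneSucc hw j).differentiable (by simp) p.1).hasDerivAt
    have h1 := (hd k).clm_apply (hasDerivAt_const p.1 (E.ι (k + 1) p.2))
    have h2 := (E.ι k).hasFDerivAt.comp_hasDerivAt p.1
      ((hd (k + 1)).clm_apply (hasDerivAt_const p.1 p.2))
    have h3 : (fun t => flatInv (b.rankOneSucc k) t (E.ι (k + 1) p.2)) =
        E.ι k ∘ fun t => flatInv (b.rankOneSucc (k + 1)) t p.2 := by
      funext t
      rw [← flatInv_rankOne_comp, Function.comp_apply, ← flatInv_rankOne_comp, flatInv_rankOne_ι]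
    -- The two expressions are the t-derivative of the same curve in level k, computed before and
    -- after inclusion.
    rw [h3] at h1
    simpa using h1.unique h2

theorem isLevelScC_projFamily (hw : StrictMono w) (n : ℕ) : b.projFamily.IsLevelScC n := by
  refine ScMap.isLevelScC_family b.projFamily (fun k => flatInv (b.rankOne k))
    (fun _ _ _ => rfl) (b.projFamilyDeriv hw) (b.contDiff_deriv_rankOneSucc hw)
    (fun k t e => ?_) n
  have hd := ((b.contDiff_rankOneSucc hw k).differentiable (by simp) t).hasDerivAt
  have h1 : HasFDerivAt (fun y : ℝ × E.lev (k + 1) => flatInv (b.rankOneSucc k) y.1) _ (t, e) :=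
    HasFDerivAt.comp (t, e) (g := flatInv (b.rankOneSucc k)) hd.hasFDerivAt hasFDerivAt_fst
  refine ((h1.clm_apply hasFDerivAt_snd).congr_fderiv ?_).congr_of_eventuallyEq
    (Eventually.of_forall fun y => b.flatInv_rankOne_comp k y.1 y.2)
  refine ContinuousLinearMap.ext fun y => ?_
  have h3 := b.flatInv_rankOne_comp k t y.2
  exact (congrArg (· + y.1 • deriv (flatInv (b.rankOneSucc k)) t e) h3).symm

/-- The curve `t ↦ exp (-1 / t²) vec (1 / t)`. -/
noncomputable def flatCurve (k : ℕ) : ℝ → E.lev k :=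
  flatInv fun r => Real.exp (-r ^ 2) • b.vec k r

theorem flatCurve_of_nonpos (k : ℕ) {t : ℝ} (ht : t ≤ 0) : b.flatCurve k t = 0 :=
  flatInv_of_nonpos _ ht

theorem flatCurve_of_pos (k : ℕ) {t : ℝ} (ht : 0 < t) :
    b.flatCurve k t = Real.exp (-t⁻¹ ^ 2) • b.vec k t⁻¹ :=
  flatInv_of_pos _ ht

theorem contDiff_flatCurve (k : ℕ) : ContDiff ℝ ∞ (b.flatCurve k) := by
  -- The Gaussian has every rate; this choice cancels the growth w k and leaves -1. Any negative
  -- total would do.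
  have := (expBound_gaussian (-1 - w k)).bilinear (b.vec_bound k)
    (ContinuousLinearMap.lsmul ℝ ℝ)
  exact this.contDiff_flatInv (by linarith)

theorem flatCurve_ι (k : ℕ) (t : ℝ) : E.ι k (b.flatCurve (k + 1) t) = b.flatCurve k t := by
  rcases le_or_gt t 0 with ht | ht
  · rw [flatCurve_of_nonpos _ _ ht, flatCurve_of_nonpos _ _ ht, map_zero]
  · rw [flatCurve_of_pos _ _ ht, flatCurve_of_pos _ _ ht, map_smul, b.vec_ι]

/-- The flat curve as a scale-continuous map. -/
noncomputable def flatCurveMap : ScMap (ScScale.const ℝ) E where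
  toFun k := b.flatCurve k
  cont k := (b.contDiff_flatCurve k).continuous
  comm k t := (b.flatCurve_ι k t).symm

/-- The functionals `exp (-1 / t²) func (1 / t)`. -/
noncomputable def flatFunc (k : ℕ) : ℝ → E.lev k →L[ℝ] ℝ :=
  flatInv fun r => Real.exp (-r ^ 2) • b.func k r

theorem contDiff_flatFunc (k : ℕ) : ContDiff ℝ ∞ (b.flatFunc k) := by
  have := (expBound_gaussian (-1 + w k)).bilinear (b.func_bound k)
    (ContinuousLinearMap.lsmul ℝ ℝ)
  exact this.contDiff_flatInv (by linarith)

theorem flatFunc_of_nonpos (k : ℕ) {t : ℝ} (ht : t ≤ 0) : b.flatFunc k t = 0 :=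
  flatInv_of_nonpos _ ht

theorem flatFunc_of_pos (k : ℕ) {t : ℝ} (ht : 0 < t) :
    b.flatFunc k t = Real.exp (-t⁻¹ ^ 2) • b.func k t⁻¹ :=
  flatInv_of_pos _ ht

theorem flatFunc_ι (k : ℕ) (t : ℝ) (e : E.lev (k + 1)) :
    b.flatFunc k t (E.ι k e) = b.flatFunc (k + 1) t e := by
  rcases le_or_gt t 0 with ht | ht
  · rw [flatFunc_of_nonpos _ _ ht, flatFunc_of_nonpos _ _ ht, _root_.zero_apply,
      _root_.zero_apply]
  · rw [flatFunc_of_pos _ _ ht, flatFunc_of_pos _ _ ht, _root_.smul_apply, _root_.smul_apply,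
      b.func_ι]

end EscapingFamily

/-- The map `h ↦ ⟨h, T ·⟩`. -/
noncomputable def innerComp {H V : Type*} [NormedAddCommGroup H] [InnerProductSpace ℝ H]
    [NormedAddCommGroup V] [NormedSpace ℝ V] (T : V →L[ℝ] H) : H →L[ℝ] V →L[ℝ] ℝ :=
  ((ContinuousLinearMap.compL ℝ V H ℝ).flip T).comp
    (isBoundedBilinearMap_inner (𝕜 := ℝ) (E := H)).toContinuousLinearMap

theorem innerComp_apply {H V : Type*} [NormedAddCommGroup H] [InnerProductSpace ℝ H]
    [NormedAddCommGroup V] [NormedSpace ℝ V] (T : V →L[ℝ] H) (h : H) (v : V) :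
    innerComp T h v = inner ℝ h (T v) := rfl

theorem HasDerivAt.innerComp {H V : Type*} [NormedAddCommGroup H] [InnerProductSpace ℝ H]
    [NormedAddCommGroup V] [NormedSpace ℝ V] (T : V →L[ℝ] H) {f : ℝ → H} {f' : H} {r : ℝ}
    (hf : HasDerivAt f f' r) :
    HasDerivAt (fun r => _root_.innerComp T (f r)) (_root_.innerComp T f') r :=
  (_root_.innerComp T).hasFDerivAt.comp_hasDerivAt r hf

/-! ### The scale of weighted Sobolev spaces -/

section SobolevScale

variable {δ : ℕ → ℝ} {hδ : StrictMono δ}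

open TestFn

theorem sobolevScale_incl_toSob (k m : ℕ) (φ : TestFn) :
    (sobolevScale δ hδ).incl k m (toSob (k + m) (δ (k + m)) φ) = toSob k (δ k) φ := by
  induction m with
  | zero => rfl
  | succ m ih =>
    rw [← ih]
    exact congrArg ((sobolevScale δ hδ).incl k m) (sobolevIncl_toSob (k + m) _ φ)

theorem weight_nonneg (hδ : StrictMono δ) (hδ0 : δ 0 = 0) (k : ℕ) : 0 ≤ δ k :=
  hδ0.symm.le.trans (hδ.monotone (Nat.zero_le k))

theorem isScBanach_sobolevScale (hδ0 : δ 0 = 0) : (sobolevScale δ hδ).IsScBanach where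
  complete k := (testTuples k (δ k)).isClosed_topologicalClosure.completeSpace_coe
  injective k := sobolevIncl_injective k (weight_nonneg hδ hδ0 _) _
  compact k := isCompactOperator_sobolevIncl k (weight_nonneg hδ hδ0 _) (hδ (Nat.lt_succ_self k))
  dense k := by
    refine (denseRange_toSob k (δ k)).mono ?_
    rintro _ ⟨φ, rfl⟩ m
    exact ⟨_, sobolevScale_incl_toSob k m φ⟩

variable (hδ) in
/-- The inclusion of level `k` of the Sobolev scale into `L²`. -/
noncomputable def sobolevToL2 (k : ℕ) : WeightedSobolev k (δ k) →L[ℝ] Lp ℝ 2 (expWeight (δ 0)) :=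
  (expWeightIncl (hδ.monotone (Nat.zero_le k))).comp (component k (δ k) 0)

theorem sobolevToL2_ι (k : ℕ) (e : WeightedSobolev (k + 1) (δ (k + 1))) :
    sobolevToL2 hδ k (sobolevIncl k (hδ (Nat.lt_succ_self k)).le e) =
      sobolevToL2 hδ (k + 1) e := by
  refine Lp.ext ((expWeightIncl_ae (hδ.monotone (Nat.zero_le k)) _).trans (EventuallyEq.trans ?_
    (expWeightIncl_ae (hδ.monotone (Nat.zero_le (k + 1))) (e.1 0)).symm))
  exact (Measure.absolutelyContinuous_of_le
    (expWeight_mono (hδ.monotone (Nat.zero_le k)))).ae_le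
      (expWeightIncl_ae (hδ (Nat.lt_succ_self k)).le _)

theorem sobolevToL2_toSob (k : ℕ) (φ : TestFn) :
    sobolevToL2 hδ k (toSob k (δ k) φ) = toL2 (δ 0) φ :=
  expWeightIncl_toL2 (hδ.monotone (Nat.zero_le k)) φ

variable (hδ) in
/-- The `L²` pairing with a test function as a functional on level `k`. -/
noncomputable def pairing (k : ℕ) (φ : TestFn) : WeightedSobolev k (δ k) →L[ℝ] ℝ :=
  innerComp (sobolevToL2 hδ k) (toL2 (δ 0) φ)

theorem pairing_toSob (hδ0 : δ 0 = 0) (k : ℕ) (φ ψ : TestFn) :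
    pairing hδ k φ (toSob k (δ k) ψ) = inner ℝ (toL2 0 φ) (toL2 0 ψ) := by
  rw [pairing, innerComp_apply, sobolevToL2_toSob, hδ0]

/-- The r-derivative of a translate is minus the translate of the derivative, so the decay from
`exists_inner_trans_le` for all test functions bounds all r-derivatives. -/
theorem expBound_pairing (hδ0 : δ 0 = 0) (k : ℕ) (φ : TestFn) :
    ExpBound (-δ k) fun r => pairing hδ k (trans r φ) := by
  refine ExpBound.of_closed (fun φ r => pairing hδ k (trans r φ)) derivT (-1)
    (fun φ r => ?_) (fun φ => ?_) φ
  · refine ((hasDerivAt_toL2_trans (δ 0) φ r).innerComp (sobolevToL2 hδ k)).congr_deriv ?_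
    rw [map_neg, neg_one_smul]
    rfl
  · obtain ⟨C, hC⟩ := exists_inner_trans_le hδ0 (hδ.monotone (Nat.zero_le k)) φ
    refine ⟨|C|, fun r _ => ContinuousLinearMap.opNorm_le_bound _ (by positivity) fun e => ?_⟩
    refine (hC r (e.1 0)).trans ?_
    gcongr
    · exact le_abs_self C
    · exact norm_component_le e 0

theorem expBound_toSob (hδ : StrictMono δ) (hδ0 : δ 0 = 0) (k : ℕ) (φ : TestFn) :
    ExpBound (δ k) fun r => toSob k (δ k) (trans r φ) :=
  ExpBound.of_closed (fun φ r => toSob k (δ k) (trans r φ)) derivT (-1)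
    (fun φ r => by
      rw [neg_one_smul]
      exact hasDerivAt_toSob_trans k (δ k) φ r)
    (fun φ => exists_norm_toSob_trans_le k (weight_nonneg hδ hδ0 k) φ) φ

variable (hδ) in
/-- The escaping family of translates of a test function. -/
noncomputable def translates (hδ0 : δ 0 = 0) (φ : TestFn) :
    EscapingFamily (sobolevScale δ hδ) δ where
  vec k r := toSob k (δ k) (trans r φ)
  func k r := pairing hδ k (trans r φ)
  vec_ι k r := sobolevIncl_toSob k _ _
  func_ι k r e := congrArg (inner ℝ (toL2 (δ 0) (trans r φ))) (sobolevToL2_ι k e)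
  vec_bound k := expBound_toSob hδ hδ0 k φ
  func_bound k := expBound_pairing hδ0 k φ
  dense k := by
    refine (denseRange_toSob k (δ k)).mono ?_
    rintro _ ⟨ψ, rfl⟩
    obtain ⟨R, hR⟩ := exists_inner_trans_eq_zero φ ψ
    exact ⟨R, fun r hr => (pairing_toSob hδ0 k _ ψ).trans (hR r hr)⟩

theorem translates_func_vec (hδ0 : δ 0 = 0) (φ ψ : TestFn) (r : ℝ) :
    (translates hδ hδ0 φ).func 0 r ((translates hδ hδ0 ψ).vec 0 r) =
      inner ℝ (toL2 0 φ) (toL2 0 ψ) :=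
  (pairing_toSob hδ0 0 _ _).trans (inner_trans_trans r φ ψ)

end SobolevScale

/-! ### A plane map with two zeros and nowhere vanishing Jacobian -/

/-- First component, in the coordinates `X` and `Q = 2 Y - s`. -/
noncomputable def planeFst (s X Y : ℝ) : ℝ :=
  Real.exp X * (6 * (2 * Y - s) ^ 2 * s ^ 2 - s ^ 4 - (2 * Y - s) ^ 4) - 4 * s ^ 4

/-- Second component, in the coordinates `X` and `Q = 2 Y - s`. -/
noncomputable def planeSnd (s X Y : ℝ) : ℝ :=
  Real.exp X * ((2 * Y - s) * ((2 * Y - s) ^ 2 - s ^ 2))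

theorem plane_zero (s : ℝ) : planeFst s 0 0 = 0 ∧ planeSnd s 0 0 = 0 := by
  simp only [planeFst, planeSnd, Real.exp_zero]
  constructor <;> ring

theorem plane_self (s : ℝ) : planeFst s 0 s = 0 ∧ planeSnd s 0 s = 0 := by
  simp only [planeFst, planeSnd, Real.exp_zero]
  constructor <;> ring

/-- The second component forces Q = 0 or Q = ±s. For Q = 0 the first is -e^X s⁴ - 4s⁴ < 0; for Q =
±s it is 4s⁴(e^X - 1), so X = 0. -/
theorem eq_of_plane_eq_zero {s X Y : ℝ} (hs : 0 < s) (h1 : planeFst s X Y = 0)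
    (h2 : planeSnd s X Y = 0) : X = 0 ∧ (Y = 0 ∨ Y = s) := by
  have hs4 : 0 < s ^ 4 := by positivity
  have hX : ∀ Q : ℝ, Q ^ 2 = s ^ 2 → Real.exp X * (6 * Q ^ 2 * s ^ 2 - s ^ 4 - Q ^ 4) -
      4 * s ^ 4 = 0 → X = 0 := by
    intro Q hQ h
    rw [show Q ^ 4 = (Q ^ 2) ^ 2 by ring, hQ] at h
    have h3 : (Real.exp X - 1) * (4 * s ^ 4) = 0 := by linarith
    rcases mul_eq_zero.1 h3 with h4 | h4
    · exact Real.exp_eq_one_iff X |>.1 (by linarith)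
    · linarith
  rw [planeSnd, mul_eq_zero, mul_eq_zero] at h2
  rcases h2 with h2 | h2 | h2
  · exact absurd h2 (Real.exp_pos X).ne'
  · rw [planeFst, h2] at h1
    nlinarith [Real.exp_pos X, mul_pos (Real.exp_pos X) hs4]
  · refine ⟨hX (2 * Y - s) (by linarith) h1, ?_⟩
    have h3 : Y * (Y - s) = 0 := by linarith
    rcases mul_eq_zero.1 h3 with h4 | h4
    · exact Or.inl h4
    · exact Or.inr (by linarith)

/-- Up to a constant factor this is the Jacobian of e^X w⁴ with w = s + iQ, divided by s; it is a
multiple of e^{2X} |w|⁶. -/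
theorem plane_det_pos {s X Q : ℝ} (hs : 0 < s) :
    0 < (Real.exp X * (6 * Q ^ 2 * s ^ 2 - s ^ 4 - Q ^ 4)) *
      (2 * (Real.exp X * (3 * Q ^ 2 - s ^ 2))) -
      (2 * (Real.exp X * (12 * Q * s ^ 2 - 4 * Q ^ 3))) *
      (Real.exp X * (Q * (Q ^ 2 - s ^ 2))) := by
  have : (Real.exp X * (6 * Q ^ 2 * s ^ 2 - s ^ 4 - Q ^ 4)) *
      (2 * (Real.exp X * (3 * Q ^ 2 - s ^ 2))) -
      (2 * (Real.exp X * (12 * Q * s ^ 2 - 4 * Q ^ 3))) *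
      (Real.exp X * (Q * (Q ^ 2 - s ^ 2))) = 2 * Real.exp X ^ 2 * (s ^ 2 + Q ^ 2) ^ 3 := by
    ring
  rw [this]
  positivity

section Plane

variable {H : Type*} [NormedAddCommGroup H] [NormedSpace ℝ H]

theorem hasFDerivAt_planeFst (s : ℝ) (f g : H →L[ℝ] ℝ) (e : H) :
    HasFDerivAt (fun e => planeFst s (f e) (g e))
      ((Real.exp (f e) * (6 * (2 * g e - s) ^ 2 * s ^ 2 - s ^ 4 - (2 * g e - s) ^ 4)) • f +
        (2 * (Real.exp (f e) * (12 * (2 * g e - s) * s ^ 2 - 4 * (2 * g e - s) ^ 3))) • g) e := by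
  have hf := f.hasFDerivAt (x := e)
  have hQ := ((g.hasFDerivAt (x := e)).const_mul 2).sub_const s
  have := (hf.exp.mul ((((hQ.pow 2).const_mul 6).mul_const (s ^ 2)).sub_const (s ^ 4) |>.sub
    (hQ.pow 4))).sub_const (4 * s ^ 4)
  refine this.congr_fderiv ?_
  ext v
  simp
  ring

theorem hasFDerivAt_planeSnd (s : ℝ) (f g : H →L[ℝ] ℝ) (e : H) :
    HasFDerivAt (fun e => planeSnd s (f e) (g e))
      ((Real.exp (f e) * ((2 * g e - s) * ((2 * g e - s) ^ 2 - s ^ 2))) • f +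
        (2 * (Real.exp (f e) * (3 * (2 * g e - s) ^ 2 - s ^ 2))) • g) e := by
  have hf := f.hasFDerivAt (x := e)
  have hQ := ((g.hasFDerivAt (x := e)).const_mul 2).sub_const s
  have := hf.exp.mul (hQ.mul ((hQ.pow 2).sub_const (s ^ 2)))
  refine this.congr_fderiv ?_
  ext v
  simp
  ring

/-- Solving a linear equation which differs from the identity on a plane only. -/
theorem exists_plane_solution {f g : H →L[ℝ] ℝ} {u v : H} (hfu : f u = 1) (hfv : f v = 0)
    (hgu : g u = 0) (hgv : g v = 1) {m₁₁ m₁₂ m₂₁ m₂₂ : ℝ} (hm : m₁₁ * m₂₂ - m₁₂ * m₂₁ ≠ 0)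
    (y : H) : ∃ a c : ℝ, ∀ x, x = y + (a • u + c • v) →
      x - (f x • u + g x • v) + ((m₁₁ * f x + m₁₂ * g x) • u + (m₂₁ * f x + m₂₂ * g x) • v) =
        y := by
  -- Cramer's rule gives the coordinates of x in the plane; subtracting those of y leaves the
  -- correction.
  refine ⟨(m₂₂ * f y - m₁₂ * g y) / (m₁₁ * m₂₂ - m₁₂ * m₂₁) - f y,
    (m₁₁ * g y - m₂₁ * f y) / (m₁₁ * m₂₂ - m₁₂ * m₂₁) - g y, fun x hx => ?_⟩
  have h1 : f x = (m₂₂ * f y - m₁₂ * g y) / (m₁₁ * m₂₂ - m₁₂ * m₂₁) := by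
    rw [hx]
    simp [hfu, hfv]
  have h2 : g x = (m₁₁ * g y - m₂₁ * f y) / (m₁₁ * m₂₂ - m₁₂ * m₂₁) := by
    rw [hx]
    simp [hgu, hgv]
  have h3 : m₁₁ * f x + m₁₂ * g x = f y := by
    rw [h1, h2, ← mul_div_assoc, ← mul_div_assoc, ← add_div, div_eq_iff hm]
    ring
  have h4 : m₂₁ * f x + m₂₂ * g x = g y := by
    rw [h1, h2, ← mul_div_assoc, ← mul_div_assoc, ← add_div, div_eq_iff hm]
    ring
  rw [h3, h4, h1, h2, hx]
  module

theorem eq_zero_of_plane_sum {f g : H →L[ℝ] ℝ} {u v : H} (hfu : f u = 1) (hfv : f v = 0)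
    (hgu : g u = 0) (hgv : g v = 1) {a c : ℝ} {e : H}
    (h : e - (f e • u + g e • v) + (a • u + c • v) = 0) :
    a = 0 ∧ c = 0 ∧ e = f e • u + g e • v := by
  have h1 := congrArg f h
  have h2 := congrArg g h
  simp [hfu, hfv] at h1
  simp [hgu, hgv] at h2
  refine ⟨h1, h2, ?_⟩
  rw [h1, h2] at h
  simpa [sub_eq_zero] using h

end Plane

/-! ### The branching map -/

namespace EscapingFamily

variable {E : ScScale} {w : ℕ → ℝ} (b g : EscapingFamily E w)

/-- The function `exp (-1 / t²)` on `t > 0`, extended by zero. -/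
noncomputable def flatScalar : ℝ → ℝ := flatInv fun r => Real.exp (-r ^ 2)

theorem contDiff_flatScalar : ContDiff ℝ ∞ flatScalar :=
  (expBound_gaussian (-1)).contDiff_flatInv (by norm_num)

theorem flatScalar_pos {t : ℝ} (ht : 0 < t) : 0 < flatScalar t := by
  rw [flatScalar, flatInv_of_pos _ ht]
  positivity

theorem flatScalar_of_pos {t : ℝ} (ht : 0 < t) : flatScalar t = Real.exp (-t⁻¹ ^ 2) :=
  flatInv_of_pos _ ht

/-- The smooth nonlinear part of the branching map. -/
noncomputable def nonlin (k : ℕ) (p : ℝ × E.lev k) : E.lev k :=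
  planeFst (flatScalar p.1 ^ 2) (b.flatFunc k p.1 p.2) (g.flatFunc k p.1 p.2) •
      b.flatCurve k p.1 +
    planeSnd (flatScalar p.1 ^ 2) (b.flatFunc k p.1 p.2) (g.flatFunc k p.1 p.2) •
      g.flatCurve k p.1

theorem contDiff_nonlin (k : ℕ) : ContDiff ℝ ∞ (b.nonlin g k) := by
  have hX : ∀ c : EscapingFamily E w,
      ContDiff ℝ ∞ fun p : ℝ × E.lev k => c.flatFunc k p.1 p.2 := fun c =>
    ((c.contDiff_flatFunc k).comp contDiff_fst).clm_apply contDiff_snd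
  have hs : ContDiff ℝ ∞ fun p : ℝ × E.lev k => flatScalar p.1 ^ 2 :=
    (contDiff_flatScalar.comp contDiff_fst).pow 2
  have hc : ∀ c : EscapingFamily E w,
      ContDiff ℝ ∞ fun p : ℝ × E.lev k => c.flatCurve k p.1 := fun c =>
    (c.contDiff_flatCurve k).comp contDiff_fst
  have h1 := hX b
  have h2 := hX g
  refine ContDiff.add (ContDiff.smul ?_ (hc b)) (ContDiff.smul ?_ (hc g))
  · unfold planeFst
    fun_prop
  · unfold planeSnd
    fun_prop

/-- `nonlin` as a scale-continuous map. -/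
noncomputable def nonlinMap : ScMap ((ScScale.const ℝ).prod E) E where
  toFun k := b.nonlin g k
  cont k := (b.contDiff_nonlin g k).continuous
  comm k p := by
    change b.nonlin g k (p.1, E.ι k p.2) = _
    simp only [nonlin, flatFunc_ι, map_add, map_smul, flatCurve_ι]

/-- The branching map
`(t, e) ↦ e - ⟨e, b⟩ b - ⟨e, g⟩ g + (flat local diffeomorphism of the plane spanned by b, g)`. -/
noncomputable def branch : ScMap ((ScScale.const ℝ).prod E) E :=
  let sndLin : ScLin ((ScScale.const ℝ).prod E) E :=
    { lin := fun _ => ContinuousLinearMap.snd ℝ _ _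
      comm := fun _ _ => rfl }
  let negLin : ScLin E E :=
    { lin := fun _ => -ContinuousLinearMap.id ℝ _
      comm := fun _ _ => by simp }
  (sndLin.toScMap.add (negLin.toScMap.comp (b.projFamily.add g.projFamily))).add (b.nonlinMap g)

theorem branch_apply (k : ℕ) (p : ℝ × E.lev k) : b.branch g k p =
    p.2 - (flatInv (b.rankOne k) p.1 p.2 + flatInv (g.rankOne k) p.1 p.2) + b.nonlin g k p := by
  rw [sub_eq_add_neg]
  rfl

theorem isLevelScC_branch (hw : StrictMono w) (n : ℕ) : (b.branch g).IsLevelScC n := by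
  refine ScMap.IsLevelScC.add (ScMap.IsLevelScC.add ?_
    (((b.isLevelScC_projFamily hw n).add (g.isLevelScC_projFamily hw n)).lin_comp _))
    (ScMap.isLevelScC_of_contDiff (b.contDiff_nonlin g))
  exact ScMap.isLevelScC_of_contDiff fun k => contDiff_snd

theorem branch_of_nonpos (k : ℕ) {t : ℝ} (ht : t ≤ 0) (e : E.lev k) :
    b.branch g k (t, e) = e := by
  rw [branch_apply, nonlin, flatInv_of_nonpos _ ht, flatInv_of_nonpos _ ht,
    flatCurve_of_nonpos _ _ ht, flatCurve_of_nonpos _ _ ht]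
  simp

theorem branch_of_pos (k : ℕ) {t : ℝ} (ht : 0 < t) (e : E.lev k) : b.branch g k (t, e) =
    e - (b.func k t⁻¹ e • b.vec k t⁻¹ + g.func k t⁻¹ e • g.vec k t⁻¹) +
      ((planeFst (flatScalar t ^ 2) ((flatScalar t • b.func k t⁻¹) e)
          ((flatScalar t • g.func k t⁻¹) e) * flatScalar t) • b.vec k t⁻¹ +
        (planeSnd (flatScalar t ^ 2) ((flatScalar t • b.func k t⁻¹) e)
          ((flatScalar t • g.func k t⁻¹) e) * flatScalar t) • g.vec k t⁻¹) := by
  rw [branch_apply, nonlin, flatInv_of_pos _ ht, flatInv_of_pos _ ht,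
    flatCurve_of_pos _ _ ht, flatCurve_of_pos _ _ ht, flatFunc_of_pos _ _ ht,
    flatFunc_of_pos _ _ ht, flatScalar_of_pos ht, rankOne_apply, rankOne_apply, smul_smul,
    smul_smul]

/-- For t > 0 the translates depend smoothly on t in every level, so the map is classically smooth;
only t = 0 needs the scale. -/
theorem contDiffOn_branch (k : ℕ) :
    ContDiffOn ℝ ∞ (b.branch g k) (Set.Ioi (0 : ℝ) ×ˢ Set.univ) := by
  have hP : ∀ c : EscapingFamily E w, ContDiffOn ℝ ∞
      (fun p : ℝ × E.lev k => flatInv (c.rankOne k) p.1 p.2) (Set.Ioi (0 : ℝ) ×ˢ Set.univ) := by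
    intro c
    refine ContDiffOn.clm_apply ?_ contDiffOn_snd
    exact (contDiffOn_flatInv (c.expBound_rankOne k).smooth).comp contDiffOn_fst
      fun p hp => hp.1
  refine ((contDiffOn_snd.sub ((hP b).add (hP g))).add
    (b.contDiff_nonlin g k).contDiffOn).congr fun p _ => b.branch_apply g k p

theorem hasFDerivAt_branch_of_pos (k : ℕ) {t : ℝ} (ht : 0 < t) (e : E.lev k) :
    HasFDerivAt (b.branch g k) (fderiv ℝ (b.branch g k) (t, e)) (t, e) := by
  have hmem : Set.Ioi (0 : ℝ) ×ˢ (Set.univ : Set (E.lev k)) ∈ 𝓝 (t, e) :=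
    prod_mem_nhds (Ioi_mem_nhds ht) univ_mem
  exact (((b.contDiffOn_branch g k).contDiffAt hmem).differentiableAt (by simp)).hasFDerivAt

open Classical in
/-- The differential of the branching map on level `0`. -/
noncomputable def branchDeriv (t : ℝ) (e : E.lev 0) : ℝ × E.lev 0 →L[ℝ] E.lev 0 :=
  if 0 < t then fderiv ℝ (b.branch g 0) (t, e) else ContinuousLinearMap.snd ℝ ℝ (E.lev 0)

theorem branchDeriv_of_pos {t : ℝ} (ht : 0 < t) (e : E.lev 0) :
    b.branchDeriv g t e = fderiv ℝ (b.branch g 0) (t, e) := if_pos ht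

theorem branchDeriv_of_nonpos {t : ℝ} (ht : t ≤ 0) (e : E.lev 0) :
    b.branchDeriv g t e = ContinuousLinearMap.snd ℝ ℝ (E.lev 0) := if_neg (not_lt.2 ht)

theorem continuous_branchDeriv (t : ℝ) : Continuous (b.branchDeriv g t) := by
  rcases le_or_gt t 0 with ht | ht
  · rw [funext (b.branchDeriv_of_nonpos g ht)]
    exact continuous_const
  · rw [funext (b.branchDeriv_of_pos g ht)]
    have h1 := (b.contDiffOn_branch g 0).continuousOn_fderiv_of_isOpen
      (isOpen_Ioi.prod isOpen_univ) (by simp)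
    exact h1.comp_continuous (Continuous.prodMk_right t) fun e => ⟨ht, trivial⟩

theorem hasFDerivAt_branch {t : ℝ} (ht : t ≠ 0) (e : E.lev 0) :
    HasFDerivAt (fun p : ℝ × E.lev 0 => b.branch g 0 p) (b.branchDeriv g t e) (t, e) := by
  rcases lt_or_gt_of_ne ht with ht | ht
  · rw [branchDeriv_of_nonpos _ _ ht.le]
    refine hasFDerivAt_snd.congr_of_eventuallyEq ?_
    filter_upwards [prod_mem_nhds (Iio_mem_nhds ht) univ_mem] with p hp
    exact b.branch_of_nonpos g 0 (le_of_lt hp.1) p.2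
  · rw [branchDeriv_of_pos _ _ ht]
    exact b.hasFDerivAt_branch_of_pos g 0 ht e

theorem hasFDerivAt_branch_slice (t : ℝ) (e : E.lev 0) :
    HasFDerivAt (fun e' : E.lev 0 => b.branch g 0 (t, e'))
      ((b.branchDeriv g t e).comp (ContinuousLinearMap.inr ℝ ℝ (E.lev 0))) e := by
  rcases le_or_gt t 0 with ht | ht
  · rw [branchDeriv_of_nonpos _ _ ht, funext (b.branch_of_nonpos g 0 ht)]
    exact hasFDerivAt_id e
  · exact (b.hasFDerivAt_branch g ht.ne' e).comp e (hasFDerivAt_prodMk_right t e)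

/-- The two families are orthonormal. -/
structure Orthonormal : Prop where
  fst_fst : ∀ r, b.func 0 r (b.vec 0 r) = 1
  fst_snd : ∀ r, b.func 0 r (g.vec 0 r) = 0
  snd_fst : ∀ r, g.func 0 r (b.vec 0 r) = 0
  snd_snd : ∀ r, g.func 0 r (g.vec 0 r) = 1

variable {b g} (ho : b.Orthonormal g)

include ho

/-- The derivative differs from the identity only through the plane of the two vectors. A solution
is thus y plus a combination of vectors lying in every level, which keeps it in the level of y. -/
theorem exists_branchDeriv_eq (k : ℕ) (t : ℝ) (e : E.lev 0) (y : E.lev k) :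
    ∃ x : E.lev k, b.branchDeriv g t e (0, E.inclZero k x) = E.inclZero k y := by
  rcases le_or_gt t 0 with ht | ht
  · exact ⟨y, by rw [branchDeriv_of_nonpos _ _ ht]; rfl⟩
  · set r := t⁻¹
    set ζ := flatScalar t
    have hζ : 0 < ζ := flatScalar_pos ht
    have hf := b.func 0 r |>.hasFDerivAt (x := e)
    have hg := g.func 0 r |>.hasFDerivAt (x := e)
    have h1 := hasFDerivAt_planeFst (ζ ^ 2) (ζ • b.func 0 r) (ζ • g.func 0 r) e
    have h2 := hasFDerivAt_planeSnd (ζ ^ 2) (ζ • b.func 0 r) (ζ • g.func 0 r) e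
    have h3 := ((hasFDerivAt_id e).sub ((hf.smul_const (b.vec 0 r)).add
      (hg.smul_const (g.vec 0 r)))).add
      (((h1.mul_const ζ).smul_const (b.vec 0 r)).add ((h2.mul_const ζ).smul_const (g.vec 0 r)))
    have h4 := b.hasFDerivAt_branch_slice g t e
    rw [funext (b.branch_of_pos g 0 ht)] at h4
    have h5 := h4.unique h3
    set X := (ζ • b.func 0 r) e
    set Q := 2 * (ζ • g.func 0 r) e - ζ ^ 2
    -- Scaling both the arguments and the value by ζ puts ζ² before each Jacobian entry, hence ζ⁴
    -- before the determinant.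
    have hdet := (mul_pos (pow_pos hζ 4) (plane_det_pos (X := X) (Q := Q) (pow_pos hζ 2))).ne'
    obtain ⟨a, c, hac⟩ := exists_plane_solution (ho.fst_fst r) (ho.fst_snd r) (ho.snd_fst r)
      (ho.snd_snd r)
      (m₁₁ := ζ ^ 2 * (Real.exp X * (6 * Q ^ 2 * (ζ ^ 2) ^ 2 - (ζ ^ 2) ^ 4 - Q ^ 4)))
      (m₁₂ := ζ ^ 2 * (2 * (Real.exp X * (12 * Q * (ζ ^ 2) ^ 2 - 4 * Q ^ 3))))
      (m₂₁ := ζ ^ 2 * (Real.exp X * (Q * (Q ^ 2 - (ζ ^ 2) ^ 2))))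
      (m₂₂ := ζ ^ 2 * (2 * (Real.exp X * (3 * Q ^ 2 - (ζ ^ 2) ^ 2))))
      (by
        convert hdet using 1
        ring) (E.inclZero k y)
    refine ⟨y + (a • b.vec k r + c • g.vec k r), ?_⟩
    set x := E.inclZero k (y + (a • b.vec k r + c • g.vec k r)) with hx
    have h6 := hac x (by simp only [hx, map_add, map_smul, inclZero_vec])
    rw [← h6]
    have h7 := DFunLike.congr_fun h5 x
    refine Eq.trans h7 ?_
    simp only [_root_.add_apply, _root_.sub_apply, ContinuousLinearMap.smulRight_apply,
      _root_.smul_apply, ContinuousLinearMap.id_apply, smul_eq_mul]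
    congr 3 <;> ring

/-- Pairing with the orthonormal vectors reduces the equation to the planar one and shows that e
lies in their span. The second planar zero ζ⟨e, g⟩ = ζ² means ⟨e, g⟩ = ζ. -/
theorem branch_eq_zero_iff (t : ℝ) (e : E.lev 0) :
    b.branch g 0 (t, e) = 0 ↔ e = 0 ∨ e = g.flatCurve 0 t := by
  rcases le_or_gt t 0 with ht | ht
  · rw [branch_of_nonpos _ _ _ ht, flatCurve_of_nonpos _ _ ht, or_self]
  rw [branch_of_pos _ _ _ ht, flatCurve_of_pos _ _ ht, ← flatScalar_of_pos ht]
  set r := t⁻¹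
  set ζ := flatScalar t
  have hζ : 0 < ζ := flatScalar_pos ht
  constructor
  · intro h
    obtain ⟨h1, h2, h3⟩ := eq_zero_of_plane_sum (ho.fst_fst r) (ho.fst_snd r) (ho.snd_fst r)
      (ho.snd_snd r) h
    obtain ⟨hX, hY⟩ := eq_of_plane_eq_zero (pow_pos hζ 2)
      ((mul_eq_zero.1 h1).resolve_right hζ.ne') ((mul_eq_zero.1 h2).resolve_right hζ.ne')
    rw [_root_.smul_apply, smul_eq_mul] at hX hY
    have hX' := (mul_eq_zero.1 hX).resolve_left hζ.ne'
    rcases hY with hY | hY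
    · have hY' := (mul_eq_zero.1 hY).resolve_left hζ.ne'
      rw [hX', hY'] at h3
      left
      simpa using h3
    · have hY' : g.func 0 r e = ζ := mul_left_cancel₀ hζ.ne' (by rw [hY, pow_two])
      rw [hX', hY'] at h3
      right
      simpa using h3
  · rintro (rfl | rfl)
    · simp [plane_zero]
    · have h1 : (ζ • b.func 0 r) (ζ • g.vec 0 r) = 0 := by simp [ho.fst_snd]
      have h2 : (ζ • g.func 0 r) (ζ • g.vec 0 r) = ζ ^ 2 := by simp [ho.snd_snd, pow_two]
      rw [h1, h2, (plane_self _).1, (plane_self _).2, map_smul, map_smul, ho.fst_snd, ho.snd_snd]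
      simp

theorem flatCurve_ne_zero {t : ℝ} (ht : 0 < t) : g.flatCurve 0 t ≠ 0 := by
  intro h
  have := congrArg (g.func 0 t⁻¹) h
  rw [flatCurve_of_pos _ _ ht, map_smul, ho.snd_snd, map_zero, smul_eq_mul, mul_one] at this
  exact (Real.exp_pos _).ne' this

end EscapingFamily

/-! ### Differentials on all levels from level 0 -/

theorem ScScale.prod_inclZero (E F : ScScale) (k : ℕ) (x : (E.prod F).lev k) :
    (E.prod F).inclZero k x = (E.inclZero k x.1, F.inclZero k x.2) := by
  induction k with
  | zero => rfl
  | succ k ih => exact ih _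

theorem ScScale.tangent_inclZero (E : ScScale) (k : ℕ) (x : E.tangent.lev k) :
    E.tangent.inclZero k x = (E.shift.inclZero k x.1, E.inclZero k x.2) := by
  induction k with
  | zero => rfl
  | succ k ih => exact ih _

theorem ScScale.const_inclZero (V : Type) [NormedAddCommGroup V] [NormedSpace ℝ V] (k : ℕ)
    (x : V) : (ScScale.const V).inclZero k x = x := by
  induction k with
  | zero => rfl
  | succ k ih => exact ih

theorem ScScale.IsScBanach.denseRange_ι {E : ScScale} (hE : E.IsScBanach) :
    DenseRange (E.ι 0) := by
  refine (hE.dense 0).mono ?_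
  intro x hx
  have hx' : ∀ m, x ∈ Set.range (E.incl 0 m) := hx
  obtain ⟨y, hy⟩ := hx' 1
  exact ⟨y, hy⟩

/-- The identity as a sc-isomorphism. -/
def ScIso.refl (E : ScScale) : ScIso E E where
  equiv k := ContinuousLinearEquiv.refl ℝ (E.lev k)
  comm _ _ := rfl

namespace EscapingFamily

variable {E : ScScale} {w : ℕ → ℝ} {b g : EscapingFamily E w}

/-- Level 1 is dense in level 0, so a bounded differential is determined by its restriction to level
1, where it is an ordinary Fréchet derivative. -/
theorem branchDeriv_ι (hE : E.IsScBanach)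
    {Th : ScMap ((ScScale.const ℝ).prod E).tangent E.tangent}
    (hTh : (b.branch g).IsLevelTangent Th) (t : ℝ) (e : E.lev 1) (y : ℝ × E.lev 0) :
    b.branchDeriv g t (E.ι 0 e) y = Th.differential 0 (t, e) y := by
  obtain ⟨L, hL, hd⟩ := hTh.diff 0 (t, e)
  have hιd : DenseRange (((ScScale.const ℝ).prod E).ι 0) :=
    Function.surjective_id.denseRange.prodMap hE.denseRange_ι
  suffices h : (b.branchDeriv g t (E.ι 0 e)).comp (((ScScale.const ℝ).prod E).ι 0) =
      L.comp (((ScScale.const ℝ).prod E).ι 0) by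
    refine Eq.trans ?_ (hL y).symm
    exact congrFun (hιd.equalizer (ContinuousLinearMap.continuous _) L.continuous
      (funext fun x => DFunLike.congr_fun h x)) y
  rcases le_or_gt t 0 with ht | ht
  -- This case includes t = 0, where no Fréchet derivative on level 0 is available. The half space t
  -- ≤ 0, on which the map is the projection to e, still determines the derivative.
  · have hu : UniqueDiffWithinAt ℝ (Set.Iic (0 : ℝ) ×ˢ (Set.univ : Set (E.lev 1))) (t, e) :=
      ((uniqueDiffOn_Iic 0).prod uniqueDiffOn_univ) _ ⟨ht, trivial⟩
    refine hu.eq ?_ hd.hasFDerivWithinAt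
    rw [branchDeriv_of_nonpos _ _ ht]
    refine HasFDerivWithinAt.congr (f := fun y : ℝ × E.lev 1 => E.ι 0 y.2) ?_
      (fun y hy => b.branch_of_nonpos g 0 hy.1 _) (b.branch_of_nonpos g 0 ht _)
    exact ((E.ι 0).hasFDerivAt.comp (t, e) hasFDerivAt_snd).hasFDerivWithinAt
  · exact HasFDerivAt.unique ((b.hasFDerivAt_branch g ht.ne' (E.ι 0 e)).comp (t, e)
      (((ScScale.const ℝ).prod E).ι 0).hasFDerivAt) hd

/-- The tangent map commutes with the inclusions, so the differential on level k restricts the one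
on level 0. -/
theorem inclZero_differential (hE : E.IsScBanach)
    {Th : ScMap ((ScScale.const ℝ).prod E).tangent E.tangent}
    (hTh : (b.branch g).IsLevelTangent Th) (k : ℕ) (t : ℝ) (e : E.lev (k + 1)) (x : E.lev k) :
    E.inclZero k (Th.differential k (t, e) (0, x)) =
      b.branchDeriv g t (E.ι 0 (E.shift.inclZero k e)) (0, E.inclZero k x) := by
  have h1 := congrArg Prod.snd (Th.inclZero_apply k ((t, e), (0, x)))
  rw [ScScale.tangent_inclZero, ScScale.tangent_inclZero] at h1
  have h2 : ((ScScale.const ℝ).prod E).inclZero k (0, x) = (0, E.inclZero k x) := by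
    rw [ScScale.prod_inclZero, ScScale.const_inclZero]
  have h3 : ((ScScale.const ℝ).prod E).shift.inclZero k (t, e) = (t, E.shift.inclZero k e) := by
    have := ScScale.prod_inclZero (ScScale.const ℝ) E.shift k (t, e)
    rwa [ScScale.const_inclZero] at this
  rw [h2, h3] at h1
  exact h1.trans (branchDeriv_ι hE hTh t _ _).symm

/-- The preimage found after inclusion into level 0 already comes from level k, and injectivity
brings the equation back. -/
theorem surjective_differential (hE : E.IsScBanach) (ho : b.Orthonormal g)
    {Th : ScMap ((ScScale.const ℝ).prod E).tangent E.tangent}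
    (hTh : (b.branch g).IsLevelTangent Th) (k : ℕ) (t : ℝ) (e : E.lev (k + 1)) (y : E.lev k) :
    ∃ x : E.lev k, Th.differential k (t, e) (0, x) = y := by
  obtain ⟨x, hx⟩ := exists_branchDeriv_eq ho k t (E.ι 0 (E.shift.inclZero k e)) y
  exact ⟨x, hE.inclZero_injective k ((inclZero_differential hE hTh k t e x).trans hx)⟩

theorem differential_zero (hE : E.IsScBanach)
    {Th : ScMap ((ScScale.const ℝ).prod E).tangent E.tangent}
    (hTh : (b.branch g).IsLevelTangent Th) (k : ℕ) (x : E.lev k) :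
    Th.differential k (0, 0) (0, x) = x := by
  have he₁ := inclZero_differential hE hTh k 0 0 x
  rw [branchDeriv_of_nonpos _ _ le_rfl] at he₁
  exact hE.inclZero_injective k he₁

/-- A sc-Banach space with two orthonormal escaping families carries a branching sc-Fredholm
map all of whose differentials are surjective. -/
theorem exists_branching (hw : StrictMono w) (hE : E.IsScBanach) (ho : b.Orthonormal g) :
    ∃ (h : ScMap ((ScScale.const ℝ).prod E) E)
      (Th : ScMap ((ScScale.const ℝ).prod E).tangent
        E.tangent)
      (Tsl : ℝ → ScMap E.tangent E.tangent)
      (z : ScMap (ScScale.const ℝ) E),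
      -- `h` is sc-smooth, with differential `dh` and partial differentials `dh_t`
      h.ScSmooth ∧ h.IsTangent Th ∧ (∀ t, (h.slice t).IsTangent (Tsl t)) ∧
      -- the partial differential `dh_0` at `0` is a sc-isomorphism
      (∃ A : ScIso E E,
        ∀ k X, (Tsl 0).differential k 0 X = A.equiv k X) ∧
      -- the zero set branches at `(0, 0)`
      z.ScSmooth ∧ (∀ t ≤ 0, z 0 t = 0) ∧ (∀ t > 0, z 0 t ≠ 0) ∧
      {p : ℝ × E.lev 0 | h 0 p = 0} =
        {p | ∃ t : ℝ, p = (t, 0) ∨ p = (t, z 0 t)} ∧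
      -- `dh (t, e) : ℝ × E k → E k` is surjective for all `(t, e)` in `ℝ × E (k+1)`
      (∀ k (t : ℝ) (e : E.lev (k + 1)),
        Function.Surjective (Th.differential k (t, e))) ∧
      -- `dh_t (e) : E k → E k` is surjective whenever `h_t (e) = 0`
      (∀ k (t : ℝ) (e : E.lev (k + 1)), h (k + 1) (t, e) = 0 →
        Function.Surjective ((Tsl t).differential k e)) ∧
      -- the same at all base points `(t, e)` in `ℝ × E 0`: there `D t e` is the classical
      -- derivative if `t ≠ 0`, and in general the unique extension of `dh (t, ·)` from `E 1` to
      -- `E 0` which is continuous for the operator norm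
      ∃ D : ℝ → E.lev 0 →
          (ℝ × E.lev 0 →L[ℝ] E.lev 0),
        (∀ t, Continuous (D t)) ∧
        (∀ (t : ℝ) (e : E.lev 1) (T : ℝ) (X : E.lev 0),
          D t (E.ι 0 e) (T, X) = Th.differential 0 (t, e) (T, X)) ∧
        (∀ t ≠ 0, ∀ e, HasFDerivAt
          (fun p : ℝ × E.lev 0 => h 0 p) (D t e) (t, e)) ∧
        (∀ (t : ℝ) e, HasFDerivAt (fun e' : E.lev 0 => h 0 (t, e'))
          ((D t e).comp (ContinuousLinearMap.inr ℝ ℝ (E.lev 0))) e) ∧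
        (∀ t e, Function.Surjective (D t e)) ∧
        (∀ (t : ℝ) e, h 0 (t, e) = 0 → Function.Surjective fun X => D t e (0, X)) := by
  obtain ⟨Th, hTh, -⟩ := b.isLevelScC_branch g hw 1
  refine ⟨b.branch g, Th, fun t => Th.sliceTangent t, g.flatCurveMap,
    fun n => (b.isLevelScC_branch g hw n).isScC, hTh.isTangent,
    fun t => (hTh.slice t).isTangent, ⟨ScIso.refl E, differential_zero hE hTh⟩,
    fun n => (ScMap.isLevelScC_of_contDiff g.contDiff_flatCurve).isScC,
    fun t ht => g.flatCurve_of_nonpos 0 ht, fun t ht => flatCurve_ne_zero ho ht, ?_,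
    fun k t e y => ?_, fun k t e _ y => surjective_differential hE ho hTh k t e y,
    b.branchDeriv g, b.continuous_branchDeriv g,
    fun t e T X => branchDeriv_ι hE hTh t e (T, X), fun t ht e => b.hasFDerivAt_branch g ht e,
    b.hasFDerivAt_branch_slice g, fun t e y => ?_, fun t e _ y => ?_⟩
  · ext ⟨t, e⟩
    refine (branch_eq_zero_iff ho t e).trans ⟨fun h => ⟨t, ?_⟩, ?_⟩
    · exact h.imp (congrArg (Prod.mk t)) (congrArg (Prod.mk t))
    · rintro ⟨s, h | h⟩ <;> obtain ⟨rfl, rfl⟩ := Prod.mk.inj h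
      · exact Or.inl rfl
      · exact Or.inr rfl
  · obtain ⟨x, hx⟩ := surjective_differential hE ho hTh k t e y
    exact ⟨(0, x), hx⟩
  · obtain ⟨x, hx⟩ := exists_branchDeriv_eq ho 0 t e y
    exact ⟨(0, x), hx⟩
  · exact exists_branchDeriv_eq ho 0 t e y

end EscapingFamily

theorem theorem2p4 (δ : ℕ → ℝ) (hδ : StrictMono δ) (hδ0 : δ 0 = 0) :
    -- the scale `E k = H^{k, δ k}(ℝ)` is a sc-Banach space with `E 0 = L²(ℝ)`
    (sobolevScale δ hδ).IsScBanach ∧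
    (∃ J : (sobolevScale δ hδ).lev 0 ≃ₗᵢ[ℝ] Lp ℝ 2 (volume : Measure ℝ),
      ∀ u, J u =ᵐ[volume] u.1 0) ∧
    ∃ (h : ScMap ((ScScale.const ℝ).prod (sobolevScale δ hδ)) (sobolevScale δ hδ))
      (Th : ScMap ((ScScale.const ℝ).prod (sobolevScale δ hδ)).tangent
        (sobolevScale δ hδ).tangent)
      (Tsl : ℝ → ScMap (sobolevScale δ hδ).tangent (sobolevScale δ hδ).tangent)
      (z : ScMap (ScScale.const ℝ) (sobolevScale δ hδ)),
      -- `h` is sc-smooth, with differential `dh` and partial differentials `dh_t`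
      h.ScSmooth ∧ h.IsTangent Th ∧ (∀ t, (h.slice t).IsTangent (Tsl t)) ∧
      -- the partial differential `dh_0` at `0` is a sc-isomorphism
      (∃ A : ScIso (sobolevScale δ hδ) (sobolevScale δ hδ),
        ∀ k X, (Tsl 0).differential k 0 X = A.equiv k X) ∧
      -- the zero set branches at `(0, 0)`
      z.ScSmooth ∧ (∀ t ≤ 0, z 0 t = 0) ∧ (∀ t > 0, z 0 t ≠ 0) ∧
      {p : ℝ × (sobolevScale δ hδ).lev 0 | h 0 p = 0} =
        {p | ∃ t : ℝ, p = (t, 0) ∨ p = (t, z 0 t)} ∧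
      -- `dh (t, e) : ℝ × E k → E k` is surjective for all `(t, e)` in `ℝ × E (k+1)`
      (∀ k (t : ℝ) (e : (sobolevScale δ hδ).lev (k + 1)),
        Function.Surjective (Th.differential k (t, e))) ∧
      -- `dh_t (e) : E k → E k` is surjective whenever `h_t (e) = 0`
      (∀ k (t : ℝ) (e : (sobolevScale δ hδ).lev (k + 1)), h (k + 1) (t, e) = 0 →
        Function.Surjective ((Tsl t).differential k e)) ∧
      -- the same at all base points `(t, e)` in `ℝ × E 0`: there `D t e` is the classical
      -- derivative if `t ≠ 0`, and in general the unique extension of `dh (t, ·)` from `E 1` to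
      -- `E 0` which is continuous for the operator norm
      ∃ D : ℝ → (sobolevScale δ hδ).lev 0 →
          (ℝ × (sobolevScale δ hδ).lev 0 →L[ℝ] (sobolevScale δ hδ).lev 0),
        (∀ t, Continuous (D t)) ∧
        (∀ (t : ℝ) (e : (sobolevScale δ hδ).lev 1) (T : ℝ) (X : (sobolevScale δ hδ).lev 0),
          D t ((sobolevScale δ hδ).ι 0 e) (T, X) = Th.differential 0 (t, e) (T, X)) ∧
        (∀ t ≠ 0, ∀ e, HasFDerivAt
          (fun p : ℝ × (sobolevScale δ hδ).lev 0 => h 0 p) (D t e) (t, e)) ∧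
        (∀ (t : ℝ) e, HasFDerivAt (fun e' : (sobolevScale δ hδ).lev 0 => h 0 (t, e'))
          ((D t e).comp (ContinuousLinearMap.inr ℝ ℝ ((sobolevScale δ hδ).lev 0))) e) ∧
        (∀ t e, Function.Surjective (D t e)) ∧
        (∀ (t : ℝ) e, h 0 (t, e) = 0 → Function.Surjective fun X => D t e (0, X)) := by
  obtain ⟨φ, ψ, h11, h22, h12⟩ := TestFn.exists_orthonormal
  have hE := isScBanach_sobolevScale (hδ := hδ) hδ0
  refine ⟨hE, TestFn.exists_sobolev_zero_equiv (δ 0) (by rw [hδ0, expWeight_zero]), ?_⟩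
  -- Translation preserves L² inner products, so orthonormality of φ and ψ holds for every r.
  have ho : (translates hδ hδ0 φ).Orthonormal (translates hδ hδ0 ψ) :=
    ⟨fun r => (translates_func_vec hδ0 φ φ r).trans h11,
      fun r => (translates_func_vec hδ0 φ ψ r).trans h12,
      fun r => (translates_func_vec hδ0 ψ φ r).trans ((real_inner_comm _ _).trans h12),
      fun r => (translates_func_vec hδ0 ψ ψ r).trans h22⟩
  exact EscapingFamily.exists_branching hδ hE ho
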